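/- **Conventions.** A network $N=N(X)$ is a connected simple graph $X$ (with vertex set $VX$ of any cardinality, not necessarily locally finite) together with a map $c:EX\to\{1,2,\dots\}$. For $A\subseteq VX$ write $A^*=VX\setminus A$, and let $\delta A$ be the set of edges with one vertex in $A$ and one in $A^*$. $A$ is a *cut* if $\delta A$ is finite, and then $c(A)=\sum_{e\in\delta A}c(e)$. A *ray* is a sequence $x_1,x_2,\dots$ of distinct vertices with $x_i,x_{i+1}$ adjacent for all $i$; for a cut $A$, every ray is eventually in $A$ or eventually in $A^*$. Two rays are equivalent if no cut separates them, i.e. no cut $A$ has one of them eventually in $A$ and the other eventually in $A^*$; $\Omega X$ is the set of equivalence classes, the (edge) ends of $X$. The elements of $VX\cup\Omega X$ are called points. A vertex lies in $A$ if it is an element of $A$, an end lies in the cut $A$ if its rays are eventually in $A$, and $A$ separates two points if one of them lies in $A$ and the other in $A^*$. A cut $A$ is *thin with respect to* the points $x,y$ if it separates them and $c(A)$ is minimal among all cuts separating $x$ and $y$; it is *thin* if it is thin with respect to some pair of points. Two cuts $A,B$ are *nested* if one of $A\cap B,\ A\cap B^*,\ A^*\cap B,\ A^*\cap B^*$ is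 empty, and $\mu(A,\mathcal C)$ denotes the number of members of $\mathcal C$ that are not nested with $A$. Let $\mathcal C_n$ be the set of thin cuts of capacity $n$. Put $\mathcal E_1=\mathcal C_1$ and, for $n\ge2$, $\mathcal D_n=\{A\in\mathcal C_n : \mu(A,\mathcal E_{n-1})=0\}$ and $\mathcal E_n=\mathcal E_{n-1}\cup\mathcal D_n'$, where $\mathcal D_n'$ consists of those $A\in\mathcal D_n$ for which there are points $x,y$ such that $A$ is thin with respect to $x,y$ and $\mu(A,\mathcal D_n)$ is minimal among all members of $\mathcal D_n$ that are thin with respect to $x,y$. For $A\in\mathcal E_n$ let $\iota A:\mathcal E_n\to\{0,1\}$ be the map with $(\iota A)(B)=1$ if and only if $A\subseteq B$ or $A^*\subsetneq B$, and let $\tau A=\iota(A^*)$. Let $T_n$ be the graph whose vertices are the maps $\iota A$, $A\in\mathcal E_n$ (one single vertex if $\mathcal E_n=\emptyset$), in which $A\in\mathcal E_n$ is a directed edge from $\iota A$ to $\tau A$, with reverse edge $A^*$. Give this edge the capacity $c(A)=c(A^*)$, and denote the result by $N(T_n)$. **Theorem.** Let $N(X)$ be a network in which $X$ is an arbitrary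 connected graph, and let $n>0$. Then: 1. $N(T_n)$ is a well-defined network and $T_n$ is a tree. Its directed edges correspond bijectively to the elements of $\mathcal E_n$, the edge given by $A$ having capacity $c(A)$. 2. There is exactly one map $\nu:VX\cup\Omega X\to VT_n\cup\Omega T_n$ such that for every $A\in\mathcal E_n$ and every point $x$ of $X$: $x$ lies in $A$ if and only if $\nu x$ lies in the cut $\{\alpha\in VT_n:\alpha(A)=1\}$ of $T_n$ (the side of the edge $A$ that contains $\iota A$). It satisfies $\nu(VX)\subseteq VT_n$, and for all $x,y\in VX\cup\Omega X$, $$\nu x=\nu y\iff x,y\text{ are not separated by any cut }A\text{ of }X\text{ with }c(A)\le n .$$ 3. The network $N(T_n)$ is canonically determined and is invariant under the automorphism group of $N(X)$: every isomorphism $\varphi$ from $N(X)$ to a network $N'(X')$ (a graph isomorphism that preserves capacities; in particular every automorphism of $N(X)$) induces an isomorphism $\psi:N(T_n)\to N'(T_n')$ of the corresponding tree networks, given by $\psi(\alpha)(\varphi(A))=\alpha(A)$ for $\alpha\in VT_n$ and $A\in\mathcal E_n$, and $\nu'\circ\varphi=\psi\circ\nu$ on $VX\cup\Omega X$, where $\nu'$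 is the corresponding map for $N'(X')$. -/

import Mathlib

universe u

/-! ### Cuts, rays and edge ends of a graph -/

namespace EdgeCut

variable {V : Type*}

/-- `δ A`: the set of edges of `G` with one vertex in `A` and the other outside `A`. -/
def boundary (G : SimpleGraph V) (A : Set V) : Set (Sym2 V) :=
  {e | e ∈ G.edgeSet ∧ ∃ x ∈ A, ∃ y ∈ Aᶜ, e = s(x, y)}

/-- A cut is a set of vertices with finite boundary (`∅` and the whole vertex set are allowed). -/
def IsCut (G : SimpleGraph V) (A : Set V) : Prop :=
  (boundary G A).Finite

/-- Two sets of vertices are nested if at least one of their four corners is empty. -/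
def Nested (A B : Set V) : Prop :=
  A ∩ B = ∅ ∨ A ∩ Bᶜ = ∅ ∨ Aᶜ ∩ B = ∅ ∨ Aᶜ ∩ Bᶜ = ∅

/-- `μ(A, 𝒞)`: the number of members of `𝒞` that are not nested with `A`. -/
noncomputable def crossingNumber (A : Set V) (C : Set (Set V)) : ℕ∞ :=
  {B | B ∈ C ∧ ¬ Nested A B}.encard

/-- A ray: an infinite sequence of distinct vertices, consecutive ones being adjacent. -/
structure Ray (G : SimpleGraph V) where
  toFun : ℕ → V
  injective : Function.Injective toFun
  adj : ∀ i, G.Adj (toFun i) (toFun (i + 1))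

/-- All but finitely many vertices of the ray lie in `A`. -/
def Ray.EventuallyIn {G : SimpleGraph V} (r : Ray G) (A : Set V) : Prop :=
  ∃ k, ∀ i, k ≤ i → r.toFun i ∈ A

/-- `A` separates the rays `r` and `r'`. -/
def SeparatesRays {G : SimpleGraph V} (A : Set V) (r r' : Ray G) : Prop :=
  (r.EventuallyIn A ∧ r'.EventuallyIn Aᶜ) ∨ (r.EventuallyIn Aᶜ ∧ r'.EventuallyIn A)

theorem Ray.eventuallyIn_or {G : SimpleGraph V} (r : Ray G) {A : Set V} (hA : IsCut G A) :
    r.EventuallyIn A ∨ r.EventuallyIn Aᶜ := by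
  have hinj : Function.Injective (fun i => s(r.toFun i, r.toFun (i + 1))) := by
    intro i j hij
    rcases Sym2.eq_iff.1 hij with ⟨h, -⟩ | ⟨h1, h2⟩
    · exact r.injective h
    · have h1 := r.injective h1
      have h2 := r.injective h2
      omega
  have hfin : {i | s(r.toFun i, r.toFun (i + 1)) ∈ boundary G A}.Finite :=
    Set.Finite.preimage hinj.injOn hA
  obtain ⟨k, hk⟩ := hfin.bddAbove
  have key : ∀ i, k + 1 ≤ i → (r.toFun i ∈ A ↔ r.toFun (i + 1) ∈ A) := by
    intro i hi
    have hn : s(r.toFun i, r.toFun (i + 1)) ∉ boundary G A := by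
      intro h
      have : i ≤ k := hk h
      omega
    constructor
    · intro h
      by_contra h'
      exact hn ⟨r.adj i, _, h, _, h', rfl⟩
    · intro h
      by_contra h'
      exact hn ⟨r.adj i, _, h, _, h', Sym2.eq_swap⟩
  have all : ∀ i, k + 1 ≤ i → (r.toFun i ∈ A ↔ r.toFun (k + 1) ∈ A) := by
    intro i hi
    induction i, hi using Nat.le_induction with
    | base => rfl
    | succ i hi ih => rw [← key i hi, ih]
  by_cases h : r.toFun (k + 1) ∈ A
  · exact Or.inl ⟨k + 1, fun i hi => (all i hi).2 h⟩
  · exact Or.inr ⟨k + 1, fun i hi h' => h ((all i hi).1 h')⟩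

theorem Ray.not_eventuallyIn_both {G : SimpleGraph V} (r : Ray G) {A : Set V}
    (h : r.EventuallyIn A) (h' : r.EventuallyIn Aᶜ) : False := by
  obtain ⟨k, hk⟩ := h
  obtain ⟨l, hl⟩ := h'
  exact hl (max k l) (le_max_right _ _) (hk (max k l) (le_max_left _ _))

/-- Two rays are equivalent if no cut separates them. -/
def raySetoid (G : SimpleGraph V) : Setoid (Ray G) where
  r r₁ r₂ := ∀ A, IsCut G A → ¬ SeparatesRays A r₁ r₂
  iseqv := by
    refine ⟨?_, ?_, ?_⟩
    · rintro r A - (⟨h, h'⟩ | ⟨h, h'⟩)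
      · exact r.not_eventuallyIn_both h h'
      · exact r.not_eventuallyIn_both h' h
    · rintro r r' h A hA (⟨h1, h2⟩ | ⟨h1, h2⟩)
      · exact h A hA (Or.inr ⟨h2, h1⟩)
      · exact h A hA (Or.inl ⟨h2, h1⟩)
    · rintro r₁ r₂ r₃ h h' A hA (⟨h1, h2⟩ | ⟨h1, h2⟩)
      · rcases r₂.eventuallyIn_or hA with h3 | h3
        · exact h' A hA (Or.inl ⟨h3, h2⟩)
        · exact h A hA (Or.inl ⟨h1, h3⟩)
      · rcases r₂.eventuallyIn_or hA with h3 | h3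
        · exact h A hA (Or.inr ⟨h1, h3⟩)
        · exact h' A hA (Or.inr ⟨h3, h2⟩)

/-- `ΩG`: the edge ends of `G`. -/
def End (G : SimpleGraph V) : Type _ := Quotient (raySetoid G)

/-- `VG ∪ ΩG`: the vertices and edge ends of `G`. -/
abbrev Point (G : SimpleGraph V) : Type _ := V ⊕ End G

/-- The point `p` lies in `A`: a vertex lies in `A` as an element, an end lies in `A` if all rays
that represent it are eventually in `A`. -/
def Point.LiesIn {G : SimpleGraph V} (A : Set V) : Point G → Prop
  | Sum.inl x => x ∈ A
  | Sum.inr ω => ∀ r : Ray G, Quotient.mk (raySetoid G) r = ω → r.EventuallyIn A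

/-- `A` separates the points `p` and `q`. -/
def Separates {G : SimpleGraph V} (A : Set V) (p q : Point G) : Prop :=
  (p.LiesIn A ∧ q.LiesIn Aᶜ) ∨ (p.LiesIn Aᶜ ∧ q.LiesIn A)

/-- The image of a ray under a graph isomorphism. -/
def Ray.map {W : Type*} {G : SimpleGraph V} {H : SimpleGraph W} (φ : G ≃g H) (r : Ray G) :
    Ray H where
  toFun i := φ (r.toFun i)
  injective := φ.injective.comp r.injective
  adj i := φ.map_adj_iff.2 (r.adj i)

theorem IsCut.preimage {W : Type*} {G : SimpleGraph V} {H : SimpleGraph W} (φ : G ≃g H)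
    {A : Set W} (hA : IsCut H A) : IsCut G (φ ⁻¹' A) := by
  have hinj : Function.Injective (Sym2.map φ) := Sym2.map.injective φ.injective
  refine (Set.Finite.preimage hinj.injOn hA).subset ?_
  rintro _ ⟨he, x, hx, y, hy, rfl⟩
  exact ⟨φ.map_adj_iff.2 he, φ x, hx, φ y, hy, rfl⟩

/-- The map on edge ends induced by a graph isomorphism. -/
def End.map {W : Type*} {G : SimpleGraph V} {H : SimpleGraph W} (φ : G ≃g H) :
    End G → End H :=
  Quotient.map' (s₁ := raySetoid G) (s₂ := raySetoid H) (Ray.map φ)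
    (fun _ _ h _ hA hsep => h _ (hA.preimage φ) hsep)

/-- The map on vertices and edge ends induced by a graph isomorphism. -/
def Point.map {W : Type*} {G : SimpleGraph V} {H : SimpleGraph W} (φ : G ≃g H) :
    Point G → Point H :=
  Sum.map φ (End.map φ)

end EdgeCut

/-! ### Networks -/

/-- A simple graph with a natural number, its capacity, assigned to every edge. -/
structure CapGraph (V : Type*) where
  graph : SimpleGraph V
  cap : graph.edgeSet → ℕ

namespace CapGraph

open EdgeCut

variable {V : Type*} (N : CapGraph V)

/-- A network: the graph is connected and all capacities are positive. -/
def IsNetwork : Prop :=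
  N.graph.Connected ∧ ∀ e, 0 < N.cap e

/-- `c(A)`: the sum of the capacities of the edges of `δ A`, for a cut `A`. -/
noncomputable def capacity (A : Set V) : ℕ :=
  ∑ᶠ (e : N.graph.edgeSet) (_ : (e : Sym2 V) ∈ boundary N.graph A), N.cap e

/-- An isomorphism of networks: a graph isomorphism that preserves the capacities. -/
structure Iso {W : Type*} (N : CapGraph V) (M : CapGraph W) where
  toIso : N.graph ≃g M.graph
  cap_eq : ∀ e, M.cap (toIso.mapEdgeSet e) = N.cap e

/-- The cut `A` is thin with respect to the points `p` and `q`: it separates them, and its capacity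
is minimal among all cuts that do. -/
def IsThinFor (A : Set V) (p q : Point N.graph) : Prop :=
  IsCut N.graph A ∧ Separates A p q ∧
    ∀ B, IsCut N.graph B → Separates B p q → N.capacity A ≤ N.capacity B

/-- `𝒞ₙ`: the thin cuts of capacity `n`. -/
def thinCuts (n : ℕ) : Set (Set V) :=
  {A | (∃ p q, N.IsThinFor A p q) ∧ N.capacity A = n}

/-- For a set `𝒟` of cuts, those `A ∈ 𝒟` that are optimally nested with respect to some pair of
points `p`, `q`: `A` is thin with respect to `p`, `q`, and `μ(A, 𝒟)` is minimal among all members of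
`𝒟` that are thin with respect to `p`, `q`. -/
def optimallyNested (D : Set (Set V)) : Set (Set V) :=
  {A | A ∈ D ∧ ∃ p q, N.IsThinFor A p q ∧
    ∀ B ∈ D, N.IsThinFor B p q → crossingNumber A D ≤ crossingNumber B D}

/-- `ℰₙ`: `ℰ₁ = 𝒞₁`, and `ℰₙ` is obtained from `ℰₙ₋₁` by adding the optimally nested members of
`𝒟ₙ = {A ∈ 𝒞ₙ | μ(A, ℰₙ₋₁) = 0}`. -/
def treeCuts : ℕ → Set (Set V)
  | 0 => ∅
  | 1 => N.thinCuts 1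
  | n + 2 => treeCuts (n + 1) ∪
      N.optimallyNested {A | A ∈ N.thinCuts (n + 2) ∧ crossingNumber A (treeCuts (n + 1)) = 0}

/-- `ι A`, for `A ∈ ℰₙ`: the map `α : ℰₙ → {0, 1}` with `α B = 1` iff `A ⊆ B` or `Aᶜ ⊂ B`,
written as the set `{B ∈ ℰₙ | α B = 1}`. -/
def initialVertex (n : ℕ) (A : Set V) : Set (Set V) :=
  {B | B ∈ N.treeCuts n ∧ (A ⊆ B ∨ Aᶜ ⊂ B)}

/-- The vertices of the structure tree `Tₙ`: all `ι A` with `A ∈ ℰₙ`; if `ℰₙ` is empty, there is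
exactly one vertex, the empty map. -/
def TreeVertex (n : ℕ) : Type _ :=
  {O : Set (Set V) // (N.treeCuts n = ∅ ∧ O = ∅) ∨ ∃ A ∈ N.treeCuts n, O = N.initialVertex n A}

/-- `A ∈ ℰₙ`, as a directed edge of the structure tree, goes from `u = ι A` to `w = τ A = ι Aᶜ`. -/
def IsTreeEdge (n : ℕ) (A : Set V) (u w : N.TreeVertex n) : Prop :=
  A ∈ N.treeCuts n ∧ u.1 = N.initialVertex n A ∧ w.1 = N.initialVertex n Aᶜ

/-- The structure tree `Tₙ`, with directed edge set `ℰₙ`, as a network `N(Tₙ)`: the edge given by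
the cuts `A` and `Aᶜ` has capacity `c(A) = c(Aᶜ)`. -/
noncomputable def structureTree (n : ℕ) : CapGraph (N.TreeVertex n) where
  graph := SimpleGraph.fromRel (fun u w => ∃ A, N.IsTreeEdge n A u w)
  cap e := sInf {k | ∃ A u w, N.IsTreeEdge n A u w ∧ (e : Sym2 (N.TreeVertex n)) = s(u, w) ∧
    k = N.capacity A}

/-- The cut of the structure tree that corresponds to `A ∈ ℰₙ`: the vertices `α` with `α A = 1`,
which is the set of vertices on the same side as `ι A` of the edge `A`. -/
def treeSide (n : ℕ) (A : Set V) : Set (N.TreeVertex n) :=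
  {w | A ∈ w.1}

/-- A map `ν : VX ∪ ΩX → VTₙ ∪ ΩTₙ` is compatible with the structure tree if a point `p` lies in a
cut `A ∈ ℰₙ` exactly when `ν p` lies in the corresponding side of the edge `A` of the tree. -/
def IsStructureMap (n : ℕ) (ν : Point N.graph → Point (N.structureTree n).graph) : Prop :=
  ∀ A ∈ N.treeCuts n, ∀ p, (ν p).LiesIn (N.treeSide n A) ↔ p.LiesIn A

end CapGraph

/-!
# The structure tree of a network

The cuts in `ℰₙ` are pairwise nested, and they separate any two points that some cut of capacity at
most `n` separates. Both facts rest on *uncrossing*. The capacity is submodular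
(`CapGraph.capacity_corners_le`): opposite corners of two crossing cuts `A`, `B` together cost no
more than `A` and `B`. On the other hand, opposite corners together cross fewer cuts than `A` and
`B` do (`EdgeCut.crossingNumber_corners_lt`). Two crossing members of `𝒟ₙ` can therefore not both
be optimally nested (`CapGraph.IsNetwork.nested_optimallyNested`), and a thin cut that crosses a
member of `ℰₙ₋₁` can be replaced by a corner with fewer such crossings
(`CapGraph.IsThinFor.exists_corner`). These arguments compare finite numbers of crossings: thin
cuts are connected on both sides, and only finitely many sets of this kind with a boundary of
bounded size have a given edge in their boundary
(`EdgeCut.finite_connectedOn_of_subset_boundary`).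
Local finiteness of the graph is not needed for this.

A vertex of the structure tree is a consistent orientation of `ℰₙ`: an upward closed choice of one
cut from each complementary pair. Orientations of vertices differ on finitely many cuts only, and a
consistent orientation is determined by any one of its minimal members
(`EdgeCut.IsTreeSet.eq_initialSet_of_minimal`). Reversing the members of the difference of two
vertices, each time one that is minimal, yields a path between them; so the tree is connected, and
any set of vertices that separates two vertices has an edge in its boundary that separates them too
(`CapGraph.IsNetwork.exists_isTreeEdge_boundary`). As only one edge reverses a given cut, every
edge is a bridge.

A point of `X` orients `ℰₙ` by the cuts that contain it. Following edges towards a consistent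
orientation, one stops at a vertex or follows a ray
(`CapGraph.IsNetwork.exists_point_of_isOrientation`), and a point of the tree is determined by the
orientation it induces (`CapGraph.IsNetwork.point_ext`). This gives existence and uniqueness of the
structure map. Since each step of the construction is preserved by isomorphisms of networks, so are
the structure tree and the structure map.
-/

/-! ### Cuts and points -/

namespace EdgeCut

variable {V : Type*} {G : SimpleGraph V} {A B : Set V}

theorem mk_mem_boundary {x y : V} :
    s(x, y) ∈ boundary G A ↔ G.Adj x y ∧ ((x ∈ A ∧ y ∉ A) ∨ (y ∈ A ∧ x ∉ A)) := by
  constructor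
  · rintro ⟨h, a, ha, b, hb, he⟩
    rcases Sym2.eq_iff.1 he with ⟨rfl, rfl⟩ | ⟨rfl, rfl⟩
    · exact ⟨h, Or.inl ⟨ha, hb⟩⟩
    · exact ⟨h, Or.inr ⟨ha, hb⟩⟩
  · rintro ⟨h, ⟨hx, hy⟩ | ⟨hy, hx⟩⟩
    · exact ⟨h, x, hx, y, hy, rfl⟩
    · exact ⟨h, y, hy, x, hx, Sym2.eq_swap⟩

theorem boundary_compl (G : SimpleGraph V) (A : Set V) : boundary G Aᶜ = boundary G A := by
  ext e
  induction e with
  | _ x y =>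
    simp only [mk_mem_boundary, Set.mem_compl_iff, not_not]
    tauto

theorem boundary_inter_subset (G : SimpleGraph V) (A B : Set V) :
    boundary G (A ∩ B) ⊆ boundary G A ∪ boundary G B := by
  intro e
  induction e with
  | _ x y =>
    simp only [mk_mem_boundary, Set.mem_union, Set.mem_inter_iff]
    tauto

theorem IsCut.compl (hA : IsCut G A) : IsCut G Aᶜ := by
  rwa [IsCut, boundary_compl]

theorem IsCut.inter (hA : IsCut G A) (hB : IsCut G B) : IsCut G (A ∩ B) :=
  (Set.Finite.union hA hB).subset (boundary_inter_subset G A B)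

theorem Ray.EventuallyIn.mono {r : Ray G} (h : r.EventuallyIn A) (hAB : A ⊆ B) :
    r.EventuallyIn B := by
  obtain ⟨k, hk⟩ := h
  exact ⟨k, fun i hi => hAB (hk i hi)⟩

theorem Ray.EventuallyIn.inter {r : Ray G} (hA : r.EventuallyIn A) (hB : r.EventuallyIn B) :
    r.EventuallyIn (A ∩ B) := by
  obtain ⟨k, hk⟩ := hA
  obtain ⟨l, hl⟩ := hB
  exact ⟨max k l, fun i hi =>
    ⟨hk i (le_trans (le_max_left _ _) hi), hl i (le_trans (le_max_right _ _) hi)⟩⟩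

/-- For a cut, it suffices to test one ray that represents the end. -/
theorem Point.liesIn_mk (hA : IsCut G A) (r : Ray G) :
    Point.LiesIn A (Sum.inr (Quotient.mk (raySetoid G) r) : Point G) ↔ r.EventuallyIn A := by
  constructor
  · intro h
    exact h r rfl
  · intro h r' hr'
    have hr : (raySetoid G).r r' r := Quotient.exact hr'
    rcases r'.eventuallyIn_or hA with h' | h'
    · exact h'
    · exact absurd (Or.inr ⟨h', h⟩) (hr A hA)

theorem Point.liesIn_compl (hA : IsCut G A) (p : Point G) : p.LiesIn Aᶜ ↔ ¬ p.LiesIn A := by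
  rcases p with x | ω
  · rfl
  · induction ω using Quotient.inductionOn with
    | _ r =>
      rw [Point.liesIn_mk hA, Point.liesIn_mk hA.compl]
      constructor
      · exact fun h h' => r.not_eventuallyIn_both h' h
      · exact fun h => (r.eventuallyIn_or hA).resolve_left h

theorem Point.LiesIn.mono {p : Point G} (h : p.LiesIn A) (hAB : A ⊆ B) : p.LiesIn B := by
  rcases p with x | ω
  · exact hAB h
  · exact fun r hr => (h r hr).mono hAB

theorem Point.liesIn_inter (p : Point G) : p.LiesIn (A ∩ B) ↔ p.LiesIn A ∧ p.LiesIn B := by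
  refine ⟨fun h => ⟨h.mono Set.inter_subset_left, h.mono Set.inter_subset_right⟩, ?_⟩
  rcases p with x | ω
  · exact id
  · exact fun h r hr => (h.1 r hr).inter (h.2 r hr)

theorem Point.LiesIn.nonempty {p : Point G} (h : p.LiesIn A) : A.Nonempty := by
  rcases p with x | ω
  · exact ⟨x, h⟩
  · induction ω using Quotient.inductionOn with
    | _ r =>
      obtain ⟨k, hk⟩ := h r rfl
      exact ⟨_, hk k le_rfl⟩

theorem separates_iff (hA : IsCut G A) (p q : Point G) :
    Separates A p q ↔ ((p.LiesIn A ∧ ¬ q.LiesIn A) ∨ (¬ p.LiesIn A ∧ q.LiesIn A)) := by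
  rw [Separates, Point.liesIn_compl hA, Point.liesIn_compl hA]

theorem Separates.compl (hA : IsCut G A) {p q : Point G} (h : Separates A p q) :
    Separates Aᶜ p q := by
  rw [separates_iff hA.compl, Point.liesIn_compl hA, Point.liesIn_compl hA]
  rw [separates_iff hA] at h
  tauto

theorem Separates.symm {p q : Point G} (h : Separates A p q) : Separates A q p := by
  unfold Separates at *
  tauto

theorem Nested.symm (h : Nested A B) : Nested B A := by
  unfold Nested at *
  simp only [Set.inter_comm B, Set.inter_comm Bᶜ]
  tauto

theorem nested_compl_left : Nested Aᶜ B ↔ Nested A B := by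
  unfold Nested
  rw [compl_compl]
  tauto

theorem nested_compl_right : Nested A Bᶜ ↔ Nested A B := by
  unfold Nested
  rw [compl_compl]
  tauto

theorem Nested.of_subset (h : A ⊆ B) : Nested A B :=
  Or.inr (Or.inl (by rw [← Set.sdiff_eq]; exact Set.sdiff_eq_empty.2 h))

/-- A set and its complement being interchangeable, two nested sets satisfy one of four
inclusions. -/
theorem nested_iff_subset : Nested A B ↔ A ⊆ Bᶜ ∨ A ⊆ B ∨ Aᶜ ⊆ Bᶜ ∨ Aᶜ ⊆ B := by
  have key : ∀ C D : Set V, C ∩ D = ∅ ↔ C ⊆ Dᶜ := fun C D =>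
    Set.disjoint_iff_inter_eq_empty.symm.trans Set.subset_compl_iff_disjoint_right.symm
  unfold Nested
  rw [key, key, key, key, compl_compl]

theorem crossingNumber_eq_zero {C : Set (Set V)} :
    crossingNumber A C = 0 ↔ ∀ B ∈ C, Nested A B := by
  rw [crossingNumber, Set.encard_eq_zero, Set.eq_empty_iff_forall_notMem]
  simp

end EdgeCut

namespace CapGraph

open EdgeCut

variable {V : Type*} {N : CapGraph V} {A B : Set V}

open Classical in
/-- The capacity of a cut, as a sum over any finite set of edges that contains its boundary. -/
theorem capacity_eq_sum (F : Finset N.graph.edgeSet)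
    (hF : ∀ e : N.graph.edgeSet, (e : Sym2 V) ∈ boundary N.graph A → e ∈ F) :
    N.capacity A = ∑ e ∈ F, if (e : Sym2 V) ∈ boundary N.graph A then N.cap e else 0 := by
  unfold capacity
  simp only [finsum_eq_if]
  refine finsum_eq_sum_of_support_subset _ ?_
  intro e he
  refine hF e ?_
  by_contra h
  simp [h] at he

theorem capacity_compl (A : Set V) : N.capacity Aᶜ = N.capacity A := by
  unfold capacity
  rw [boundary_compl]

theorem exists_finset_edges {S : Set (Sym2 V)} (hS : S.Finite) :
    ∃ F : Finset N.graph.edgeSet, ∀ e : N.graph.edgeSet, (e : Sym2 V) ∈ S ↔ e ∈ F := by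
  have := hS.preimage (Subtype.val_injective (p := (· ∈ N.graph.edgeSet))).injOn
  exact ⟨this.toFinset, fun e => by simp⟩

/-- Submodularity of the capacity, for a pair of opposite corners. -/
theorem capacity_corners_le (hA : IsCut N.graph A) (hB : IsCut N.graph B) :
    N.capacity (A ∩ B) + N.capacity (Aᶜ ∩ Bᶜ) ≤ N.capacity A + N.capacity B := by
  classical
  obtain ⟨F, hF⟩ := exists_finset_edges (N := N) (Set.Finite.union hA hB)
  have h1 := boundary_inter_subset N.graph A B
  have h2 := boundary_inter_subset N.graph Aᶜ Bᶜ
  rw [boundary_compl, boundary_compl] at h2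
  rw [capacity_eq_sum (A := A) F fun e he => (hF e).1 (Or.inl he),
    capacity_eq_sum (A := B) F fun e he => (hF e).1 (Or.inr he),
    capacity_eq_sum (A := A ∩ B) F fun e he => (hF e).1 (h1 he),
    capacity_eq_sum (A := Aᶜ ∩ Bᶜ) F fun e he => (hF e).1 (h2 he),
    ← Finset.sum_add_distrib, ← Finset.sum_add_distrib]
  refine Finset.sum_le_sum fun e _ => ?_
  obtain ⟨e, he⟩ := e
  induction e with
  | _ x y =>
    have hadj : N.graph.Adj x y := he
    simp only [mk_mem_boundary, Set.mem_inter_iff, Set.mem_compl_iff, hadj, true_and]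
    by_cases hxA : x ∈ A <;> by_cases hyA : y ∈ A <;> by_cases hxB : x ∈ B <;>
      by_cases hyB : y ∈ B <;> simp [hxA, hyA, hxB, hyB]

/-- If no edge joins `B` to the rest of `A`, then the capacity of `A` is distributed over `B` and
`A \ B`. -/
theorem capacity_split (hA : IsCut N.graph A) (hBA : B ⊆ A)
    (hB : ∀ x ∈ B, ∀ y ∈ A, N.graph.Adj x y → y ∈ B) :
    IsCut N.graph B ∧ N.capacity A = N.capacity B + N.capacity (A ∩ Bᶜ) := by
  classical
  have h1 : boundary N.graph B ⊆ boundary N.graph A := by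
    rintro _ ⟨he, x, hx, y, hy, rfl⟩
    exact ⟨he, x, hBA hx, y, fun h => hy (hB x hx y h he), rfl⟩
  have hcut : IsCut N.graph B := Set.Finite.subset hA h1
  have h2 : boundary N.graph (A ∩ Bᶜ) ⊆ boundary N.graph A := by
    rintro _ ⟨he, x, hx, y, hy, rfl⟩
    exact ⟨he, x, hx.1, y, fun h =>
      hy ⟨h, fun hyB => hx.2 (hB y hyB x hx.1 (SimpleGraph.Adj.symm he))⟩, rfl⟩
  obtain ⟨F, hF⟩ := exists_finset_edges (N := N) hA
  refine ⟨hcut, ?_⟩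
  rw [capacity_eq_sum (A := A) F fun e he => (hF e).1 he,
    capacity_eq_sum (A := B) F fun e he => (hF e).1 (h1 he),
    capacity_eq_sum (A := A ∩ Bᶜ) F fun e he => (hF e).1 (h2 he), ← Finset.sum_add_distrib]
  refine Finset.sum_congr rfl fun e _ => ?_
  obtain ⟨e, he⟩ := e
  induction e with
  | _ x y =>
    have hadj : N.graph.Adj x y := he
    have a1 := @hBA x
    have a2 := @hBA y
    have a3 := fun h h' => hB x h y h' hadj
    have a4 := fun h h' => hB y h x h' hadj.symm
    simp only [mk_mem_boundary, Set.mem_inter_iff, Set.mem_compl_iff, hadj, true_and]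
    by_cases hxA : x ∈ A <;> by_cases hyA : y ∈ A <;> by_cases hxB : x ∈ B <;>
      by_cases hyB : y ∈ B <;> simp_all

theorem IsNetwork.capacity_pos (hN : N.IsNetwork) (hA : IsCut N.graph A) (h : A.Nonempty)
    (h' : Aᶜ.Nonempty) : 0 < N.capacity A := by
  classical
  obtain ⟨x, hx⟩ := h
  obtain ⟨y, hy⟩ := h'
  obtain ⟨w⟩ := hN.1 x y
  obtain ⟨d, -, hd1, hd2⟩ := w.exists_boundary_dart A hx hy
  obtain ⟨F, hF⟩ := exists_finset_edges (N := N) hA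
  rw [capacity_eq_sum F fun e he => (hF e).1 he]
  have hd : s(d.fst, d.snd) ∈ boundary N.graph A := mk_mem_boundary.2 ⟨d.adj, Or.inl ⟨hd1, hd2⟩⟩
  refine Finset.sum_pos' (fun _ _ => Nat.zero_le _) ⟨⟨s(d.fst, d.snd), d.adj⟩, (hF _).1 hd, ?_⟩
  rw [if_pos hd]
  exact hN.2 _

/-- As all capacities are positive, a cut has at most as many edges as its capacity. -/
theorem IsNetwork.ncard_boundary_le (hN : N.IsNetwork) (hA : IsCut N.graph A) :
    (boundary N.graph A).ncard ≤ N.capacity A := by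
  classical
  obtain ⟨F, hF⟩ := exists_finset_edges (N := N) hA
  rw [capacity_eq_sum F fun e he => (hF e).1 he]
  have h1 : boundary N.graph A ⊆ ((F.image Subtype.val : Finset (Sym2 V)) : Set (Sym2 V)) := by
    intro e he
    have : (⟨e, he.1⟩ : N.graph.edgeSet) ∈ F := (hF _).1 he
    simpa using ⟨he.1, this⟩
  calc (boundary N.graph A).ncard ≤ (F.image Subtype.val).card := by
        rw [← Set.ncard_coe_finset]
        exact Set.ncard_le_ncard h1 (Finset.finite_toSet _)
    _ ≤ F.card := Finset.card_image_le
    _ = ∑ e ∈ F, 1 := by simp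
    _ ≤ _ := Finset.sum_le_sum fun e he => by
        rw [if_pos ((hF e).2 he)]
        exact hN.2 e

end CapGraph

/-! ### Finiteness of the set of thin cuts of bounded capacity -/

namespace EdgeCut

variable {V : Type*} {G : SimpleGraph V} {A B : Set V}

/-- `A` induces a connected (or empty) subgraph of `G`: the only nonempty part of `A` that is closed
under adjacency inside `A` is `A` itself. -/
def ConnectedOn (G : SimpleGraph V) (A : Set V) : Prop :=
  ∀ C ⊆ A, C.Nonempty → (∀ x ∈ C, ∀ y ∈ A, G.Adj x y → y ∈ C) → A ⊆ C

/-- In any graph there are only finitely many sets `B`, connected with connected complement, that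
separate two given adjacent vertices and whose boundary has bounded size. The induction fixes a
set `S` of boundary edges and bounds the number of the remaining ones. -/
theorem finite_connectedOn_of_subset_boundary (u v : V) (k : ℕ) (S : Finset (Sym2 V))
    (huv : s(u, v) ∈ S) :
    {B : Set V | ConnectedOn G B ∧ ConnectedOn G Bᶜ ∧ u ∈ B ∧ v ∉ B ∧ IsCut G B ∧
      (S : Set (Sym2 V)) ⊆ boundary G B ∧ (boundary G B).ncard ≤ S.card + k}.Finite := by
  classical
  induction k generalizing S with
  | zero =>
    -- `B` is determined by its boundary, which is `S`
    refine Set.Subsingleton.finite ?_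
    rintro B ⟨hB, hBc, huB, hvB, hfin, hSB, hcard⟩ C ⟨hC, hCc, huC, hvC, hfin', hSC, hcard'⟩
    have h1 : boundary G B = S := (Set.eq_of_subset_of_ncard_le hSB
      (by rwa [Set.ncard_coe_finset]) hfin).symm
    have h2 : boundary G C = S := (Set.eq_of_subset_of_ncard_le hSC
      (by rwa [Set.ncard_coe_finset]) hfin').symm
    have h12 : boundary G B = boundary G C := h1.trans h2.symm
    -- a connected set that meets another set with the same boundary cannot leave it
    have key : ∀ B C : Set V, ConnectedOn G B → u ∈ B → u ∈ C → boundary G B = boundary G C →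
        B ⊆ C := by
      intro B C hB huB huC h12
      have := hB (B ∩ C) Set.inter_subset_left ⟨u, huB, huC⟩ (by
        rintro x ⟨hxB, hxC⟩ y hyB hxy
        refine ⟨hyB, ?_⟩
        by_contra hyC
        have : s(x, y) ∈ boundary G B := h12 ▸ mk_mem_boundary.2 ⟨hxy, Or.inl ⟨hxC, hyC⟩⟩
        rw [mk_mem_boundary] at this
        tauto)
      exact fun x hx => (this hx).2
    exact (key B C hB huB huC h12).antisymm (key C B hC huC huB h12.symm)
  | succ k ih =>
    by_cases hr : (G.deleteEdges (S : Set (Sym2 V))).Reachable u v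
    · -- a walk from `u` to `v` that avoids `S` meets the boundary in an edge outside `S`
      obtain ⟨w⟩ := hr
      have hfin : (⋃ f ∈ {f | f ∈ w.edges ∧ f ∉ S}, {B : Set V | ConnectedOn G B ∧
          ConnectedOn G Bᶜ ∧ u ∈ B ∧ v ∉ B ∧ IsCut G B ∧
          ((insert f S : Finset (Sym2 V)) : Set (Sym2 V)) ⊆ boundary G B ∧
          (boundary G B).ncard ≤ (insert f S).card + k}).Finite := by
        refine Set.Finite.biUnion ?_ fun f _ => ih (insert f S) (Finset.mem_insert_of_mem huv)
        exact (List.finite_toSet w.edges).subset fun f hf => hf.1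
      refine hfin.subset ?_
      rintro B ⟨hB, hBc, huB, hvB, hcut, hSB, hcard⟩
      obtain ⟨d, hd, hd1, hd2⟩ := w.exists_boundary_dart B huB hvB
      have hadj := SimpleGraph.deleteEdges_adj.1 d.adj
      have hdS : d.edge ∉ S := by
        have := hadj.2
        rwa [Finset.mem_coe] at this
      have hdB : d.edge ∈ boundary G B := mk_mem_boundary.2 ⟨hadj.1, Or.inl ⟨hd1, hd2⟩⟩
      have hdw : d.edge ∈ w.edges := List.mem_map_of_mem hd
      refine Set.mem_biUnion (show d.edge ∈ {f | f ∈ w.edges ∧ f ∉ S} from ⟨hdw, hdS⟩)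
        ⟨hB, hBc, huB, hvB, hcut, ?_, ?_⟩
      · rw [Finset.coe_insert]
        exact Set.insert_subset hdB hSB
      · rw [Finset.card_insert_of_notMem hdS]
        omega
    · -- otherwise `B` is the component of `u` after deletion of `S`
      refine Set.Subsingleton.finite ?_
      suffices h : ∀ B ∈ {B : Set V | ConnectedOn G B ∧ ConnectedOn G Bᶜ ∧ u ∈ B ∧ v ∉ B ∧
          IsCut G B ∧ (S : Set (Sym2 V)) ⊆ boundary G B ∧
          (boundary G B).ncard ≤ S.card + (k + 1)},
          B = {x | (G.deleteEdges (S : Set (Sym2 V))).Reachable u x} from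
        fun B hB C hC => (h B hB).trans (h C hC).symm
      rintro B ⟨hB, hBc, huB, hvB, -, hSB, -⟩
      have step : ∀ x y, G.Adj x y → (x ∈ B ↔ y ∈ B) →
          (G.deleteEdges (S : Set (Sym2 V))).Reachable u x →
          (G.deleteEdges (S : Set (Sym2 V))).Reachable u y := by
        intro x y hxy hB hx
        refine hx.trans (SimpleGraph.Adj.reachable (SimpleGraph.deleteEdges_adj.2 ⟨hxy, ?_⟩))
        intro h
        have := (mk_mem_boundary.1 (hSB h)).2
        tauto
      refine Set.Subset.antisymm ?_ ?_
      · have := hB (B ∩ {x | (G.deleteEdges (S : Set (Sym2 V))).Reachable u x})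
          Set.inter_subset_left ⟨u, huB, SimpleGraph.Reachable.refl u⟩
          (fun x hx y hy hxy => ⟨hy, step x y hxy (iff_of_true hx.1 hy) hx.2⟩)
        exact fun x hx => (this hx).2
      · intro x hx
        by_contra hxB
        have := hBc (Bᶜ ∩ {x | (G.deleteEdges (S : Set (Sym2 V))).Reachable u x})
          Set.inter_subset_left ⟨x, hxB, hx⟩
          (fun x hx y hy hxy => ⟨hy, step x y hxy (iff_of_false hx.1 hy) hx.2⟩)
        exact hr (this hvB).2

end EdgeCut

namespace CapGraph

open EdgeCut

variable {V : Type*} {N : CapGraph V} {A B : Set V} {p q : Point N.graph}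

theorem IsThinFor.symm (h : N.IsThinFor A p q) : N.IsThinFor A q p :=
  ⟨h.1, h.2.1.symm, fun B hB hs => h.2.2 B hB hs.symm⟩

theorem IsThinFor.compl (h : N.IsThinFor A p q) : N.IsThinFor Aᶜ p q :=
  ⟨h.1.compl, h.2.1.compl h.1, fun B hB hs => (capacity_compl A).trans_le (h.2.2 B hB hs)⟩

theorem compl_mem_thinCuts {n : ℕ} (h : A ∈ N.thinCuts n) : Aᶜ ∈ N.thinCuts n := by
  obtain ⟨⟨p, q, h⟩, hn⟩ := h
  exact ⟨⟨p, q, h.compl⟩, (capacity_compl A).trans hn⟩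

theorem IsThinFor.nonempty (h : N.IsThinFor A p q) : A.Nonempty := by
  rcases h.2.1 with h | h
  · exact h.1.nonempty
  · exact h.2.nonempty

/-- A set that has the capacity of a thin cut and separates the same points is thin too. -/
theorem IsThinFor.of_capacity_le (h : N.IsThinFor A p q) (hB : IsCut N.graph B)
    (hs : Separates B p q) (hc : N.capacity B ≤ N.capacity A) : N.IsThinFor B p q :=
  ⟨hB, hs, fun C hC hCs => hc.trans (h.2.2 C hC hCs)⟩

/-- Thin cuts are connected: a part of `A` not joined to the rest of `A` either separates the two
points at a smaller cost, or leaves a rest that does. -/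
theorem IsThinFor.connectedOn (hN : N.IsNetwork) (h : N.IsThinFor A p q) :
    ConnectedOn N.graph A := by
  intro C hCA hC hclosed
  by_contra hAC
  have hAC' : (A ∩ Cᶜ).Nonempty := by
    obtain ⟨x, hx, hx'⟩ := Set.not_subset.1 hAC
    exact ⟨x, hx, hx'⟩
  obtain ⟨hcut, hcap⟩ := capacity_split h.1 hCA hclosed
  have hcut' : IsCut N.graph (A ∩ Cᶜ) := h.1.inter hcut.compl
  have hAc : Aᶜ.Nonempty := h.compl.nonempty
  have h1 : 0 < N.capacity C := hN.capacity_pos hcut hC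
    (hAc.mono (Set.compl_subset_compl.2 hCA))
  have h2 : 0 < N.capacity (A ∩ Cᶜ) := hN.capacity_pos hcut' hAC'
    (hAc.mono (Set.compl_subset_compl.2 Set.inter_subset_left))
  have hsep : Separates C p q ∨ Separates (A ∩ Cᶜ) p q := by
    have hs := (separates_iff h.1 p q).1 h.2.1
    have m1 : p.LiesIn C → p.LiesIn A := fun h => h.mono hCA
    have m2 : q.LiesIn C → q.LiesIn A := fun h => h.mono hCA
    rw [separates_iff hcut, separates_iff hcut', Point.liesIn_inter, Point.liesIn_inter,
      Point.liesIn_compl hcut, Point.liesIn_compl hcut]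
    tauto
  rcases hsep with hs | hs
  · have := h.2.2 _ hcut hs
    omega
  · have := h.2.2 _ hcut' hs
    omega

/-- Only finitely many thin cuts of bounded capacity separate two given vertices. -/
theorem IsNetwork.finite_thinCuts_separating (hN : N.IsNetwork) (n : ℕ) (x y : V) :
    {B | (∃ m ≤ n, B ∈ N.thinCuts m) ∧ x ∈ B ∧ y ∉ B}.Finite := by
  obtain ⟨w⟩ := hN.1 x y
  have hfin : (⋃ d ∈ {d | d ∈ w.darts}, {B : Set V | ConnectedOn N.graph B ∧
      ConnectedOn N.graph Bᶜ ∧ d.fst ∈ B ∧ d.snd ∉ B ∧ IsCut N.graph B ∧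
      (({s(d.fst, d.snd)} : Finset (Sym2 V)) : Set (Sym2 V)) ⊆ boundary N.graph B ∧
      (boundary N.graph B).ncard ≤ ({s(d.fst, d.snd)} : Finset (Sym2 V)).card + n}).Finite :=
    Set.Finite.biUnion (List.finite_toSet _) fun d _ =>
      finite_connectedOn_of_subset_boundary _ _ _ _ (Finset.mem_singleton_self _)
  refine hfin.subset ?_
  rintro B ⟨⟨m, hm, ⟨p, q, hB⟩, hc⟩, hx, hy⟩
  obtain ⟨d, hd, hd1, hd2⟩ := w.exists_boundary_dart B hx hy
  refine Set.mem_biUnion (show d ∈ {d | d ∈ w.darts} from hd) ⟨hB.connectedOn hN,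
    hB.compl.connectedOn hN, hd1, hd2, hB.1, ?_, ?_⟩
  · rw [Finset.coe_singleton, Set.singleton_subset_iff]
    exact mk_mem_boundary.2 ⟨d.adj, Or.inl ⟨hd1, hd2⟩⟩
  · have := hN.ncard_boundary_le hB.1
    omega

/-- Only finitely many thin cuts of bounded capacity cross a given cut: each of them separates two
end vertices of the boundary edges of that cut. -/
theorem IsNetwork.finite_thinCuts_crossing (hN : N.IsNetwork) (n : ℕ) (hA : IsCut N.graph A) :
    {B | (∃ m ≤ n, B ∈ N.thinCuts m) ∧ ¬ Nested A B}.Finite := by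
  have hF : {x | ∃ e ∈ boundary N.graph A, x ∈ e}.Finite := by
    have : {x | ∃ e ∈ boundary N.graph A, x ∈ e} = ⋃ e ∈ boundary N.graph A, {x | x ∈ e} := by
      ext; simp
    rw [this]
    refine Set.Finite.biUnion hA fun e _ => ?_
    induction e with
    | _ x y =>
      refine (Set.toFinite {x, y}).subset fun z hz => ?_
      simpa using hz
  refine (Set.Finite.biUnion hF fun x _ => Set.Finite.biUnion hF fun y _ =>
    hN.finite_thinCuts_separating n x y).subset ?_
  have key : ∀ B, ConnectedOn N.graph B → ¬ Nested A B →
      ∃ x ∈ {x | ∃ e ∈ boundary N.graph A, x ∈ e}, x ∈ B := by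
    intro B hB hAB
    unfold Nested at hAB
    push Not at hAB
    obtain ⟨h1, -, h3, -⟩ := hAB
    by_contra hno
    obtain ⟨z, hz1, hz2⟩ := h3
    refine hz1 (hB (A ∩ B) Set.inter_subset_right h1 ?_ hz2).1
    intro x hx y hy hxy
    refine ⟨?_, hy⟩
    by_contra hyA
    exact hno ⟨x, ⟨s(x, y), mk_mem_boundary.2 ⟨hxy, Or.inl ⟨hx.1, hyA⟩⟩, by simp⟩, hx.2⟩
  rintro B ⟨⟨m, hm, ⟨p, q, hB⟩, hc⟩, hAB⟩
  obtain ⟨x, hx, hxB⟩ := key B (hB.connectedOn hN) hAB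
  obtain ⟨y, hy, hyB⟩ := key Bᶜ (hB.compl.connectedOn hN) (mt nested_compl_right.1 hAB)
  exact Set.mem_biUnion hx (Set.mem_biUnion hy ⟨⟨m, hm, ⟨p, q, hB⟩, hc⟩, hxB, hyB⟩)

end CapGraph

/-! ### Corners of crossing cuts -/

namespace EdgeCut

variable {V : Type*} {A B C : Set V}

/-- A set nested with two crossing sets is, up to complementation, contained in one of their
corners, hence nested with all of them. -/
theorem Nested.inter (hAB : ¬ Nested A B) (hA : Nested A C) (hB : Nested B C) :
    Nested (A ∩ B) C := by
  rw [nested_iff_subset] at *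
  simp only [Set.subset_def, Set.mem_inter_iff, Set.mem_compl_iff] at *
  push Not at hAB
  rcases hA with h | h | h | h <;> rcases hB with h' | h' | h' | h'
  all_goals first
    | exact Or.inl fun x hx => by have := h x; have := h' x; tauto
    | exact Or.inr (Or.inl fun x hx => by have := h x; have := h' x; tauto)
    | exact Or.inr (Or.inr (Or.inl fun x hx => by have := h x; have := h' x; tauto))
    | exact Or.inr (Or.inr (Or.inr fun x hx => by have := h x; have := h' x; tauto))

theorem nested_inter_self (A B : Set V) : Nested (A ∩ B) A :=
  Nested.of_subset Set.inter_subset_left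

/-- A set that is nested with `A` is nested with one of any two sets on different sides of `A`. -/
theorem Nested.or_of_subset {P Q : Set V} (h : Nested A C) (hP : P ⊆ A) (hQ : Q ⊆ Aᶜ) :
    Nested P C ∨ Nested Q C := by
  simp only [nested_iff_subset] at *
  rcases h with h | h | h | h
  · exact Or.inl (Or.inl (hP.trans h))
  · exact Or.inl (Or.inr (Or.inl (hP.trans h)))
  · exact Or.inr (Or.inl (hQ.trans h))
  · exact Or.inr (Or.inr (Or.inl (hQ.trans h)))

theorem crossingNumber_compl (A : Set V) (D : Set (Set V)) :
    crossingNumber Aᶜ D = crossingNumber A D := by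
  simp only [crossingNumber, nested_compl_left]

/-- Replacing a cut `A` by a corner that it forms with a crossing member of a nested set lowers the
number of crossings with that nested set. -/
theorem crossingNumber_inter_lt {E : Set (Set V)} (hE : ∀ B ∈ E, ∀ C ∈ E, Nested B C)
    (hfin : {C | C ∈ E ∧ ¬ Nested A C}.Finite) (hB : B ∈ E) (hAB : ¬ Nested A B) :
    crossingNumber (A ∩ B) E < crossingNumber A E := by
  have hss : {C | C ∈ E ∧ ¬ Nested (A ∩ B) C} ⊂ {C | C ∈ E ∧ ¬ Nested A C} := by
    refine (Set.ssubset_iff_of_subset ?_).2 ⟨B, ⟨hB, hAB⟩, fun h => h.2 ?_⟩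
    · rintro C ⟨hC, hC'⟩
      exact ⟨hC, fun h => hC' (h.inter hAB (hE B hB C hC))⟩
    · rw [Set.inter_comm]
      exact nested_inter_self B A
  exact (hfin.subset hss.subset).encard_lt_encard hss

/-- The numbers of crossings of two opposite corners add up to less than those of the two crossing
sets. -/
theorem crossingNumber_corners_lt {D : Set (Set V)} (hA : A ∈ D) (hAB : ¬ Nested A B)
    (hfA : {C | C ∈ D ∧ ¬ Nested A C}.Finite) (hfB : {C | C ∈ D ∧ ¬ Nested B C}.Finite) :
    crossingNumber (A ∩ B) D + crossingNumber (Aᶜ ∩ Bᶜ) D <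
      crossingNumber A D + crossingNumber B D := by
  unfold crossingNumber
  rw [← Set.encard_union_add_encard_inter, ← Set.encard_union_add_encard_inter {C | C ∈ D ∧
    ¬ Nested A C}]
  have hAB' : ¬ Nested Aᶜ Bᶜ := by rwa [nested_compl_left, nested_compl_right]
  have h1 : {C | C ∈ D ∧ ¬ Nested (A ∩ B) C} ∪ {C | C ∈ D ∧ ¬ Nested (Aᶜ ∩ Bᶜ) C} ⊂
      {C | C ∈ D ∧ ¬ Nested A C} ∪ {C | C ∈ D ∧ ¬ Nested B C} := by
    refine (Set.ssubset_iff_of_subset ?_).2 ⟨A, Or.inr ⟨hA, fun h => hAB h.symm⟩, ?_⟩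
    · rintro C (⟨hC, h⟩ | ⟨hC, h⟩)
      · by_contra hno
        simp only [Set.mem_union, Set.mem_ofPred_eq, hC, true_and, not_or, not_not] at hno
        exact h (hno.1.inter hAB hno.2)
      · by_contra hno
        simp only [Set.mem_union, Set.mem_ofPred_eq, hC, true_and, not_or, not_not] at hno
        exact h ((nested_compl_left.2 hno.1).inter hAB' (nested_compl_left.2 hno.2))
    · rintro (⟨-, h⟩ | ⟨-, h⟩)
      · exact h (nested_inter_self A B)
      · exact h (nested_compl_right.1 (nested_inter_self Aᶜ Bᶜ))
  have h2 : {C | C ∈ D ∧ ¬ Nested (A ∩ B) C} ∩ {C | C ∈ D ∧ ¬ Nested (Aᶜ ∩ Bᶜ) C} ⊆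
      {C | C ∈ D ∧ ¬ Nested A C} ∩ {C | C ∈ D ∧ ¬ Nested B C} := by
    rintro C ⟨⟨hC, h⟩, -, h'⟩
    refine ⟨⟨hC, fun hn => ?_⟩, hC, fun hn => ?_⟩
    · rcases hn.or_of_subset (Set.inter_subset_left (t := B)) (Set.inter_subset_left (t := Bᶜ))
        with hn | hn
      · exact h hn
      · exact h' hn
    · rcases hn.or_of_subset (Set.inter_subset_right (s := A)) (Set.inter_subset_right (s := Aᶜ))
        with hn | hn
      · exact h hn
      · exact h' hn
  have hfin := hfA.union hfB
  refine ENat.add_lt_add_of_lt_of_le ?_ ((hfin.subset h1.subset).encard_lt_encard h1)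
    (Set.encard_le_encard h2)
  exact (((hfA.inter_of_left _).subset h2).encard_lt_top).ne

end EdgeCut

/-! ### Uncrossing thin cuts; the cuts in `ℰₙ` -/

namespace CapGraph

open EdgeCut

variable {V : Type*} {N : CapGraph V} {A B : Set V} {p q u v : Point N.graph} {n : ℕ}

theorem IsThinFor.exists_orient (h : N.IsThinFor A p q) :
    ∃ p' q' : Point N.graph, N.IsThinFor A p' q' ∧ p'.LiesIn A ∧ ¬ q'.LiesIn A ∧
      (∀ B, Separates B p q ↔ Separates B p' q') := by
  rcases (separates_iff h.1 p q).1 h.2.1 with hs | hs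
  · exact ⟨p, q, h, hs.1, hs.2, fun B => Iff.rfl⟩
  · exact ⟨q, p, h.symm, hs.2, hs.1, fun B => ⟨Separates.symm, Separates.symm⟩⟩

theorem IsThinFor.congr_points (h : N.IsThinFor A p q)
    (hs : ∀ B, Separates B p q ↔ Separates B u v) : N.IsThinFor A u v :=
  ⟨h.1, (hs A).1 h.2.1, fun B hB hB' => h.2.2 B hB ((hs B).2 hB')⟩

theorem isCut_of_mem_thinCuts (h : A ∈ N.thinCuts n) : IsCut N.graph A := by
  obtain ⟨⟨p, q, h⟩, -⟩ := h
  exact h.1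

/-- Uncrossing: if `A` is thin with respect to `p`, `q` and crosses a thin cut `B` that does not
separate these points, then some corner of `A` and `B` is also thin with respect to `p`, `q`. The
opposite corner separates the points that `B` separates and so is no cheaper than `B`. -/
theorem IsThinFor.exists_corner (hA : N.IsThinFor A p q) (hB : N.IsThinFor B u v)
    (hpq : ¬ Separates B p q) :
    ∃ A' B', (A' = A ∨ A' = Aᶜ) ∧ (B' = B ∨ B' = Bᶜ) ∧ N.IsThinFor (A' ∩ B') p q := by
  obtain ⟨p', q', hA', hp, hq, hs⟩ := hA.exists_orient
  obtain ⟨u', v', hB', hu, hv, -⟩ := hB.exists_orient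
  rw [hs] at hpq
  suffices h : ∃ A' B', (A' = A ∨ A' = Aᶜ) ∧ (B' = B ∨ B' = Bᶜ) ∧
      Separates (A' ∩ B') p' q' ∧ Separates (A'ᶜ ∩ B'ᶜ) u' v' by
    obtain ⟨A', B', h1, h2, h3, h4⟩ := h
    have hcA : IsCut N.graph A' := by
      rcases h1 with rfl | rfl
      exacts [hA.1, hA.1.compl]
    have hcB : IsCut N.graph B' := by
      rcases h2 with rfl | rfl
      exacts [hB.1, hB.1.compl]
    have e1 : N.capacity A' = N.capacity A := by
      rcases h1 with rfl | rfl
      exacts [rfl, capacity_compl A]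
    have e2 : N.capacity B' = N.capacity B := by
      rcases h2 with rfl | rfl
      exacts [rfl, capacity_compl B]
    refine ⟨A', B', h1, h2, hA.of_capacity_le (hcA.inter hcB) ((hs _).2 h3) ?_⟩
    have := capacity_corners_le hcA hcB
    have := hB'.2.2 _ (hcA.compl.inter hcB.compl) h4
    omega
  rw [separates_iff hB.1] at hpq
  -- `B'` is the side of `B` that contains `p` and `q`; the point of `u`, `v` on the other side
  -- decides which of the two corners in `B'` has an opposite corner that separates `u` from `v`
  by_cases hpB : p'.LiesIn B
  · by_cases hvA : v'.LiesIn A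
    · refine ⟨Aᶜ, B, Or.inr rfl, Or.inl rfl, ?_, ?_⟩
      · rw [separates_iff (hA.1.compl.inter hB.1)]
        simp only [Point.liesIn_inter, Point.liesIn_compl hA.1]
        tauto
      · rw [compl_compl, separates_iff (hA.1.inter hB.1.compl)]
        simp only [Point.liesIn_inter, Point.liesIn_compl hB.1]
        tauto
    · refine ⟨A, B, Or.inl rfl, Or.inl rfl, ?_, ?_⟩
      · rw [separates_iff (hA.1.inter hB.1)]
        simp only [Point.liesIn_inter]
        tauto
      · rw [separates_iff (hA.1.compl.inter hB.1.compl)]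
        simp only [Point.liesIn_inter, Point.liesIn_compl hB.1, Point.liesIn_compl hA.1]
        tauto
  · by_cases huA : u'.LiesIn A
    · refine ⟨Aᶜ, Bᶜ, Or.inr rfl, Or.inr rfl, ?_, ?_⟩
      · rw [separates_iff (hA.1.compl.inter hB.1.compl)]
        simp only [Point.liesIn_inter, Point.liesIn_compl hB.1, Point.liesIn_compl hA.1]
        tauto
      · rw [compl_compl, compl_compl, separates_iff (hA.1.inter hB.1)]
        simp only [Point.liesIn_inter]
        tauto
    · refine ⟨A, Bᶜ, Or.inl rfl, Or.inr rfl, ?_, ?_⟩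
      · rw [separates_iff (hA.1.inter hB.1.compl)]
        simp only [Point.liesIn_inter, Point.liesIn_compl hB.1]
        tauto
      · rw [compl_compl, separates_iff (hA.1.compl.inter hB.1)]
        simp only [Point.liesIn_inter, Point.liesIn_compl hA.1]
        tauto

/-- Let `A` and `B` cross, each with as few crossings as possible among the cuts of capacity `n`
nested with `E` that are thin with respect to `x`, `y` and to `u`, `v`, respectively. If each of two opposite
corners separates one of these pairs, then both corners have capacity `n` and compete with `A` and
`B`, which by `crossingNumber_corners_lt` leaves little room. -/
theorem IsNetwork.optimal_corners (hN : N.IsNetwork) {E D : Set (Set V)}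
    (hD : D = {A | A ∈ N.thinCuts n ∧ crossingNumber A E = 0}) (hAD : A ∈ D) (hBD : B ∈ D)
    {x y u v : Point N.graph} (hAt : N.IsThinFor A x y) (hBt : N.IsThinFor B u v)
    (hAm : ∀ C ∈ D, N.IsThinFor C x y → crossingNumber A D ≤ crossingNumber C D)
    (hBm : ∀ C ∈ D, N.IsThinFor C u v → crossingNumber B D ≤ crossingNumber C D)
    (hAB : ¬ Nested A B) :
    (Separates (A ∩ B) x y → Separates (Aᶜ ∩ Bᶜ) u v → False) ∧
    (Separates (A ∩ B) u v → Separates (Aᶜ ∩ Bᶜ) x y → False) ∧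
    (Separates (A ∩ B) x y → Separates (Aᶜ ∩ Bᶜ) x y →
      crossingNumber A D < crossingNumber B D) ∧
    (Separates (A ∩ B) u v → Separates (Aᶜ ∩ Bᶜ) u v →
      crossingNumber B D < crossingNumber A D) := by
  have hfin : ∀ C, IsCut N.graph C → {B | B ∈ D ∧ ¬ Nested C B}.Finite := fun C hC =>
    (hN.finite_thinCuts_crossing n hC).subset fun B hB => ⟨⟨n, le_rfl, (hD ▸ hB.1).1⟩, hB.2⟩
  have hfA : crossingNumber A D ≠ ⊤ := (hfin A hAt.1).encard_lt_top.ne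
  have hfB : crossingNumber B D ≠ ⊤ := (hfin B hBt.1).encard_lt_top.ne
  have hlt := crossingNumber_corners_lt (A := A) (B := B) hAD hAB (hfin A hAt.1) (hfin B hBt.1)
  have hmem : ∀ C, C ∈ D ↔ C ∈ N.thinCuts n ∧ crossingNumber C E = 0 := fun C => by rw [hD]; rfl
  rw [hmem] at hAD hBD
  have hcA := hAD.1.2
  have hcB := hBD.1.2
  have hEA := crossingNumber_eq_zero.1 hAD.2
  have hEB := crossingNumber_eq_zero.1 hBD.2
  have hAB' : ¬ Nested Aᶜ Bᶜ := by rwa [nested_compl_left, nested_compl_right]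
  have hP := hAt.1.inter hBt.1
  have hQ := hAt.1.compl.inter hBt.1.compl
  have hcap := capacity_corners_le hAt.1 hBt.1
  have hPE : crossingNumber (A ∩ B) E = 0 :=
    crossingNumber_eq_zero.2 fun C hC => (hEA C hC).inter hAB (hEB C hC)
  have hQE : crossingNumber (Aᶜ ∩ Bᶜ) E = 0 :=
    crossingNumber_eq_zero.2 fun C hC =>
      (nested_compl_left.2 (hEA C hC)).inter hAB' (nested_compl_left.2 (hEB C hC))
  have low : ∀ C, IsCut N.graph C → (Separates C x y ∨ Separates C u v) → n ≤ N.capacity C := by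
    rintro C hC (h | h)
    · exact hcA ▸ hAt.2.2 C hC h
    · exact hcB ▸ hBt.2.2 C hC h
  have up1 : ∀ C, IsCut N.graph C → crossingNumber C E = 0 → N.capacity C ≤ n →
      Separates C x y → crossingNumber A D ≤ crossingNumber C D := by
    intro C hC hCE hCn hs
    have ht : N.IsThinFor C x y := hAt.of_capacity_le hC hs (hcA ▸ hCn)
    exact hAm C ((hmem C).2 ⟨⟨⟨x, y, ht⟩, hCn.antisymm (low C hC (Or.inl hs))⟩, hCE⟩) ht
  have up2 : ∀ C, IsCut N.graph C → crossingNumber C E = 0 → N.capacity C ≤ n →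
      Separates C u v → crossingNumber B D ≤ crossingNumber C D := by
    intro C hC hCE hCn hs
    have ht : N.IsThinFor C u v := hBt.of_capacity_le hC hs (hcB ▸ hCn)
    exact hBm C ((hmem C).2 ⟨⟨⟨u, v, ht⟩, hCn.antisymm (low C hC (Or.inr hs))⟩, hCE⟩) ht
  refine ⟨fun h1 h2 => ?_, fun h1 h2 => ?_, fun h1 h2 => ?_, fun h1 h2 => ?_⟩
  · have l1 := low _ hP (Or.inl h1)
    have l2 := low _ hQ (Or.inr h2)
    exact absurd (add_le_add (up1 _ hP hPE (by omega) h1) (up2 _ hQ hQE (by omega) h2))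
      (not_le.2 hlt)
  · have l1 := low _ hP (Or.inr h1)
    have l2 := low _ hQ (Or.inl h2)
    have := add_le_add (up2 _ hP hPE (by omega) h1) (up1 _ hQ hQE (by omega) h2)
    rw [add_comm] at this
    exact absurd this (not_le.2 hlt)
  · have l1 := low _ hP (Or.inl h1)
    have l2 := low _ hQ (Or.inl h2)
    have := (add_le_add (up1 _ hP hPE (by omega) h1) (up1 _ hQ hQE (by omega) h2)).trans_lt hlt
    exact (ENat.add_lt_add_iff_left hfA).1 this
  · have l1 := low _ hP (Or.inr h1)
    have l2 := low _ hQ (Or.inr h2)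
    have := (add_le_add (up2 _ hP hPE (by omega) h1) (up2 _ hQ hQE (by omega) h2)).trans_lt hlt
    exact (ENat.add_lt_add_iff_right hfB).1 this

/-- Optimally nested cuts among the thin cuts of capacity `n` that are nested with `E` do not cross:
otherwise, wherever the two pairs of points lie, some pair of opposite corners would be thin and
have too few crossings. Only if each pair of points lies in a pair of opposite corners, and not the same
one, are both pairs of corners needed: then each of `A` and `B` would have fewer crossings than the
other. -/
theorem IsNetwork.nested_optimallyNested (hN : N.IsNetwork) (E : Set (Set V))
    (hA : A ∈ N.optimallyNested {A | A ∈ N.thinCuts n ∧ crossingNumber A E = 0})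
    (hB : B ∈ N.optimallyNested {A | A ∈ N.thinCuts n ∧ crossingNumber A E = 0}) :
    Nested A B := by
  by_contra hAB
  obtain ⟨hAD, x₀, y₀, hAt₀, hAm₀⟩ := hA
  obtain ⟨hBD, u₀, v₀, hBt₀, hBm₀⟩ := hB
  obtain ⟨x, y, hAt, hx, hy, hxy⟩ := hAt₀.exists_orient
  obtain ⟨u, v, hBt, hu, hv, huv⟩ := hBt₀.exists_orient
  generalize hD : {A | A ∈ N.thinCuts n ∧ crossingNumber A E = 0} = D at *
  have hAm : ∀ C ∈ D, N.IsThinFor C x y → crossingNumber A D ≤ crossingNumber C D :=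
    fun C hC h => hAm₀ C hC (h.congr_points fun B => (hxy B).symm)
  have hBm : ∀ C ∈ D, N.IsThinFor C u v → crossingNumber B D ≤ crossingNumber C D :=
    fun C hC h => hBm₀ C hC (h.congr_points fun B => (huv B).symm)
  have hBD' : Bᶜ ∈ D := by
    rw [← hD] at hBD ⊢
    exact ⟨compl_mem_thinCuts hBD.1, (crossingNumber_compl B E).trans hBD.2⟩
  have k1 := hN.optimal_corners hD.symm hAD hBD hAt hBt hAm hBm hAB
  have k2 := hN.optimal_corners hD.symm hAD hBD' hAt hBt.compl hAm
    (fun C hC h => (crossingNumber_compl B D).trans_le (hBm C hC h))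
    (mt nested_compl_right.1 hAB)
  rw [compl_compl, crossingNumber_compl] at k2
  have cA := hAt.1
  have cB := hBt.1
  simp only [separates_iff (cA.inter cB), separates_iff (cA.compl.inter cB.compl),
    separates_iff (cA.inter cB.compl), separates_iff (cA.compl.inter cB),
    Point.liesIn_inter, Point.liesIn_compl cA, Point.liesIn_compl cB, hx, hy, hu, hv]
    at k1 k2
  have hlt := @lt_asymm _ _ (crossingNumber A D) (crossingNumber B D)
  -- what remains is a case distinction on the corners that contain the four points
  generalize (crossingNumber A D < crossingNumber B D) = P at k1 k2 hlt
  generalize (crossingNumber B D < crossingNumber A D) = Q at k1 k2 hlt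
  clear * - k1 k2 hlt
  by_cases h1 : x.LiesIn B <;> by_cases h2 : y.LiesIn B <;> by_cases h3 : u.LiesIn A <;>
    by_cases h4 : v.LiesIn A <;> simp [h1, h2, h3, h4] at k1 k2 hlt <;> simp_all

/-- Thin cuts of capacity one do not cross: the single edge that bounds `B` cannot join the two
parts of `A` and also the two parts of `Aᶜ`. -/
theorem IsNetwork.nested_of_mem_thinCuts_one (hN : N.IsNetwork) (hA : A ∈ N.thinCuts 1)
    (hB : B ∈ N.thinCuts 1) : Nested A B := by
  by_contra hAB
  obtain ⟨⟨p, q, hA⟩, -⟩ := hA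
  obtain ⟨⟨u, v, hB⟩, hcB⟩ := hB
  have huniq : ∀ e ∈ boundary N.graph B, ∀ f ∈ boundary N.graph B, e = f :=
    (Set.ncard_le_one hB.1).1 (hcB ▸ hN.ncard_boundary_le hB.1)
  have key : ∀ A, ConnectedOn N.graph A → ¬ Nested A B →
      ∃ x ∈ A, ∃ y ∈ A, s(x, y) ∈ boundary N.graph B := by
    intro A hA hAB
    unfold Nested at hAB
    push Not at hAB
    obtain ⟨h1, ⟨z, hz⟩, -, -⟩ := hAB
    by_contra hno
    refine hz.2 (hA (A ∩ B) Set.inter_subset_left h1 ?_ hz.1).2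
    intro x hx y hy hxy
    refine ⟨hy, ?_⟩
    by_contra hyB
    exact hno ⟨x, hx.1, y, hy, mk_mem_boundary.2 ⟨hxy, Or.inl ⟨hx.2, hyB⟩⟩⟩
  obtain ⟨x, hx, y, hy, h⟩ := key A (hA.connectedOn hN) hAB
  obtain ⟨x', hx', y', hy', h'⟩ := key Aᶜ (hA.compl.connectedOn hN) (mt nested_compl_left.1 hAB)
  rcases Sym2.eq_iff.1 (huniq _ h _ h') with ⟨rfl, -⟩ | ⟨rfl, -⟩
  · exact hx' hx
  · exact hy' hx

/-- The recursion for `ℰₙ` also holds for the step from `ℰ₀ = ∅` to `ℰ₁ = 𝒞₁`, since thin cuts of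
capacity one do not cross each other. -/
theorem IsNetwork.treeCuts_succ (hN : N.IsNetwork) (n : ℕ) :
    N.treeCuts (n + 1) = N.treeCuts n ∪ N.optimallyNested
      {A | A ∈ N.thinCuts (n + 1) ∧ crossingNumber A (N.treeCuts n) = 0} := by
  rcases n with _ | n
  · have h0 : ∀ A ∈ N.thinCuts 1, crossingNumber A (N.thinCuts 1) = 0 := fun A hA =>
      crossingNumber_eq_zero.2 fun B hB => hN.nested_of_mem_thinCuts_one hA hB
    have h1 : {A | A ∈ N.thinCuts (0 + 1) ∧ crossingNumber A (N.treeCuts 0) = 0} =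
        N.thinCuts 1 := by
      ext A
      refine and_iff_left (crossingNumber_eq_zero.2 fun B hB => hB.elim)
    rw [h1]
    ext A
    simp only [treeCuts, Set.empty_union]
    constructor
    · intro hA
      obtain ⟨p, q, h⟩ := hA.1
      exact ⟨hA, p, q, h, fun B _ _ => (h0 A hA).trans_le zero_le⟩
    · exact fun hA => hA.1
  · rfl

theorem IsNetwork.mem_thinCuts_of_mem_treeCuts (hN : N.IsNetwork) (hA : A ∈ N.treeCuts n) :
    ∃ m ≤ n, A ∈ N.thinCuts m := by
  induction n with
  | zero => exact hA.elim
  | succ n ih =>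
    rw [hN.treeCuts_succ] at hA
    rcases hA with hA | hA
    · obtain ⟨m, hm, h⟩ := ih hA
      exact ⟨m, hm.trans n.le_succ, h⟩
    · exact ⟨n + 1, le_rfl, hA.1.1⟩

theorem IsNetwork.compl_mem_treeCuts (hN : N.IsNetwork) (hA : A ∈ N.treeCuts n) :
    Aᶜ ∈ N.treeCuts n := by
  induction n with
  | zero => exact hA.elim
  | succ n ih =>
    rw [hN.treeCuts_succ] at hA ⊢
    rcases hA with hA | ⟨hA, p, q, h, hm⟩
    · exact Or.inl (ih hA)
    · refine Or.inr ⟨⟨compl_mem_thinCuts hA.1, ?_⟩, p, q, h.compl, fun B hB hBt => ?_⟩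
      · rw [crossingNumber_compl]
        exact hA.2
      · rw [crossingNumber_compl]
        exact hm B hB hBt

/-- The cuts of `ℰₙ` are pairwise nested. -/
theorem IsNetwork.nested_of_mem_treeCuts (hN : N.IsNetwork) (hA : A ∈ N.treeCuts n)
    (hB : B ∈ N.treeCuts n) : Nested A B := by
  induction n generalizing A B with
  | zero => exact hA.elim
  | succ n ih =>
    rw [hN.treeCuts_succ] at hA hB
    rcases hA with hA | hA <;> rcases hB with hB | hB
    · exact ih hA hB
    · exact (crossingNumber_eq_zero.1 hB.1.2 A hA).symm
    · exact crossingNumber_eq_zero.1 hA.1.2 B hB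
    · exact hN.nested_optimallyNested _ hA hB

/-- Points that are separated by some cut of capacity at most `n` are separated by a cut of
`ℰₙ`. -/
theorem IsNetwork.exists_mem_treeCuts_separates (hN : N.IsNetwork)
    (h : ∃ A, IsCut N.graph A ∧ N.capacity A ≤ n ∧ Separates A p q) :
    ∃ A ∈ N.treeCuts n, Separates A p q := by
  induction n with
  | zero =>
    obtain ⟨A, hA, hc, hs⟩ := h
    have hne : A.Nonempty ∧ Aᶜ.Nonempty := by
      rcases hs with hs | hs
      · exact ⟨hs.1.nonempty, hs.2.nonempty⟩
      · exact ⟨hs.2.nonempty, hs.1.nonempty⟩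
    exact absurd (hN.capacity_pos hA hne.1 hne.2) (by omega)
  | succ n ih =>
    by_cases h' : ∃ A, IsCut N.graph A ∧ N.capacity A ≤ n ∧ Separates A p q
    · obtain ⟨A, hA, hs⟩ := ih h'
      exact ⟨A, by rw [hN.treeCuts_succ]; exact Or.inl hA, hs⟩
    have hlow : ∀ B, IsCut N.graph B → Separates B p q → n + 1 ≤ N.capacity B := by
      intro B hB hs
      by_contra hlt
      exact h' ⟨B, hB, by omega, hs⟩
    obtain ⟨A₀, hA₀, hc₀, hs₀⟩ := h
    have ht₀ : N.IsThinFor A₀ p q := ⟨hA₀, hs₀, fun B hB hs => hc₀.trans (hlow B hB hs)⟩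
    -- a thin cut with as few crossings with `ℰₙ` as possible has none
    obtain ⟨A₁, ht₁, hm₁⟩ := exists_minimalFor_of_wellFoundedLT (fun A => N.IsThinFor A p q)
      (fun A => crossingNumber A (N.treeCuts n)) ⟨A₀, ht₀⟩
    have hcap : ∀ A, N.IsThinFor A p q → N.capacity A = n + 1 := fun A hA =>
      ((hA.2.2 A₀ hA₀ hs₀).trans hc₀).antisymm (hlow A hA.1 hA.2.1)
    have hz : crossingNumber A₁ (N.treeCuts n) = 0 := by
      rw [crossingNumber_eq_zero]
      intro B hB
      by_contra hAB
      obtain ⟨m, hm, ⟨u, v, hBt⟩, hBc⟩ := hN.mem_thinCuts_of_mem_treeCuts hB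
      have hBs : ¬ Separates B p q := by
        intro hs
        have := hlow B hBt.1 hs
        omega
      obtain ⟨A', B', hA', hB', ht⟩ := ht₁.exists_corner hBt hBs
      have hμ : crossingNumber A' (N.treeCuts n) = crossingNumber A₁ (N.treeCuts n) := by
        rcases hA' with rfl | rfl
        exacts [rfl, crossingNumber_compl _ _]
      have hAB' : ¬ Nested A' B' := by
        rcases hA' with rfl | rfl <;> rcases hB' with rfl | rfl <;>
          simpa only [nested_compl_left, nested_compl_right] using hAB
      have hBm : B' ∈ N.treeCuts n := by
        rcases hB' with rfl | rfl
        exacts [hB, hN.compl_mem_treeCuts hB]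
      have hcut : IsCut N.graph A' := by
        rcases hA' with rfl | rfl
        exacts [ht₁.1, ht₁.1.compl]
      have hlt := crossingNumber_inter_lt
        (fun B hB C hC => hN.nested_of_mem_treeCuts hB hC)
        ((hN.finite_thinCuts_crossing n hcut).subset fun C hC =>
          ⟨hN.mem_thinCuts_of_mem_treeCuts hC.1, hC.2⟩) hBm hAB'
      rw [hμ] at hlt
      exact absurd (hm₁ ht hlt.le) (not_le.2 hlt)
    obtain ⟨A₂, ⟨hD₂, ht₂⟩, hm₂⟩ := exists_minimalFor_of_wellFoundedLT
      (fun A => A ∈ {A | A ∈ N.thinCuts (n + 1) ∧ crossingNumber A (N.treeCuts n) = 0} ∧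
        N.IsThinFor A p q)
      (fun A => crossingNumber A
        {A | A ∈ N.thinCuts (n + 1) ∧ crossingNumber A (N.treeCuts n) = 0})
      ⟨A₁, ⟨⟨⟨p, q, ht₁⟩, hcap A₁ ht₁⟩, hz⟩, ht₁⟩
    refine ⟨A₂, ?_, ht₂.2.1⟩
    rw [hN.treeCuts_succ]
    refine Or.inr ⟨hD₂, p, q, ht₂, fun B hB hBt => ?_⟩
    exact le_of_not_gt fun hlt => absurd (hm₂ ⟨hB, hBt⟩ hlt.le) (not_le.2 hlt)

end CapGraph

/-! ### Tree sets and their orientations -/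

namespace EdgeCut

variable {V : Type*} {E O O' : Set (Set V)} {A B : Set V}

/-- A tree set: a set of nonempty, pairwise nested sets that is closed under complementation and of
which only finitely many members separate any two given vertices. -/
structure IsTreeSet (E : Set (Set V)) : Prop where
  compl_mem : ∀ A ∈ E, Aᶜ ∈ E
  nonempty : ∀ A ∈ E, A.Nonempty
  nested : ∀ A ∈ E, ∀ B ∈ E, Nested A B
  finite_separating : ∀ x y, {A | A ∈ E ∧ x ∈ A ∧ y ∉ A}.Finite

/-- A consistent orientation of `E`: it contains exactly one of every two complementary members of
`E` and is closed upwards. -/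
structure IsOrientation (E O : Set (Set V)) : Prop where
  subset : O ⊆ E
  mem_or : ∀ A ∈ E, A ∈ O ∨ Aᶜ ∈ O
  compl_notMem : ∀ A ∈ O, Aᶜ ∉ O
  mem_of_subset : ∀ A ∈ O, ∀ B ∈ E, A ⊆ B → B ∈ O

/-- The orientation of `E` given by the initial vertex of `A`, as a set. -/
def initialSet (E : Set (Set V)) (A : Set V) : Set (Set V) :=
  {B | B ∈ E ∧ (A ⊆ B ∨ Aᶜ ⊂ B)}

theorem IsOrientation.notMem_iff (hO : IsOrientation E O) (hA : A ∈ E) : A ∉ O ↔ Aᶜ ∈ O := by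
  constructor
  · exact fun h => (hO.mem_or A hA).resolve_left h
  · exact fun h h' => hO.compl_notMem A h' h

theorem IsOrientation.eq_of_subset (hO : IsOrientation E O) (hO' : IsOrientation E O')
    (h : O ⊆ O') : O = O' := by
  refine h.antisymm fun A hA => ?_
  by_contra hno
  exact hO'.compl_notMem A hA (h ((hO.notMem_iff (hO'.subset hA)).1 hno))

theorem mem_initialSet_self (hA : A ∈ E) : A ∈ initialSet E A :=
  ⟨hA, Or.inl subset_rfl⟩

theorem IsTreeSet.compl_notMem_initialSet (hE : IsTreeSet E) (hA : A ∈ E) :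
    Aᶜ ∉ initialSet E A := by
  rintro ⟨-, h | h⟩
  · obtain ⟨x, hx⟩ := hE.nonempty A hA
    exact h hx hx
  · exact h.2 subset_rfl

/-- Reversing an edge only changes the orientation of that edge. -/
theorem mem_initialSet_compl (h1 : B ≠ A) (h2 : B ≠ Aᶜ) :
    B ∈ initialSet E Aᶜ ↔ B ∈ initialSet E A := by
  have e1 : A ⊂ B ↔ A ⊆ B := ⟨fun h => h.1, fun h => h.ssubset_of_ne h1.symm⟩
  have e2 : Aᶜ ⊂ B ↔ Aᶜ ⊆ B := ⟨fun h => h.1, fun h => h.ssubset_of_ne h2.symm⟩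
  simp only [initialSet, Set.mem_ofPred_eq, compl_compl, e1, e2]
  tauto

theorem IsTreeSet.isOrientation_initialSet (hE : IsTreeSet E) (hA : A ∈ E) :
    IsOrientation E (initialSet E A) where
  subset := fun B hB => hB.1
  mem_or := by
    intro B hB
    by_cases h1 : B = A
    · exact Or.inl (h1 ▸ mem_initialSet_self (h1 ▸ hB))
    by_cases h2 : B = Aᶜ
    · refine Or.inr ?_
      rw [h2, compl_compl]
      exact mem_initialSet_self hA
    have h3 : A ≠ Bᶜ := fun h => h2 (by rw [h, compl_compl])
    rcases nested_iff_subset.1 (hE.nested A hA B hB) with h | h | h | h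
    · exact Or.inr ⟨hE.compl_mem B hB, Or.inl h⟩
    · exact Or.inl ⟨hB, Or.inl h⟩
    · exact Or.inr ⟨hE.compl_mem B hB,
        Or.inr (h.ssubset_of_ne fun h => h1 (compl_injective h).symm)⟩
    · exact Or.inl ⟨hB, Or.inr (h.ssubset_of_ne fun h => h2 h.symm)⟩
  compl_notMem := by
    rintro B ⟨hB, h⟩ ⟨-, h'⟩
    obtain ⟨x, hx⟩ := hE.nonempty A hA
    obtain ⟨y, hy⟩ := hE.nonempty _ (hE.compl_mem A hA)
    rcases h with h | h <;> rcases h' with h' | h'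
    · exact h' hx (h hx)
    · exact h'.2 (Set.compl_subset_compl.2 h)
    · exact h.2 (Set.subset_compl_comm.1 h')
    · exact h'.1 hy (h.1 hy)
  mem_of_subset := by
    rintro B ⟨hB, h | h⟩ C hC hBC
    · exact ⟨hC, Or.inl (h.trans hBC)⟩
    · exact ⟨hC, Or.inr (h.trans_subset hBC)⟩

/-- Only finitely many members of the orientation of a vertex miss a given element of `V`. -/
theorem IsTreeSet.finite_initialSet_notMem (hE : IsTreeSet E) (hA : A ∈ E) (x : V) :
    {B | B ∈ initialSet E A ∧ x ∉ B}.Finite := by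
  obtain ⟨a, ha⟩ := hE.nonempty A hA
  obtain ⟨b, hb⟩ := hE.nonempty _ (hE.compl_mem A hA)
  refine ((hE.finite_separating a x).union (hE.finite_separating b x)).subset ?_
  rintro B ⟨⟨hB, h | h⟩, hx⟩
  · exact Or.inl ⟨hB, h ha, hx⟩
  · exact Or.inr ⟨hB, h.1 hb, hx⟩

theorem IsTreeSet.finite_initialSet_subset (hE : IsTreeSet E) (hA : A ∈ E) {C : Set V}
    (hC : C ∈ E) : {B | B ∈ initialSet E A ∧ B ⊆ C}.Finite := by
  obtain ⟨x, hx⟩ := hE.nonempty _ (hE.compl_mem C hC)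
  exact (hE.finite_initialSet_notMem hA x).subset fun B hB => ⟨hB.1, fun h => hx (hB.2 h)⟩

theorem IsTreeSet.finite_initialSet_diff (hE : IsTreeSet E) (hA : A ∈ E) (hB : B ∈ E) :
    (initialSet E A \ initialSet E B).Finite := by
  obtain ⟨a, ha⟩ := hE.nonempty B hB
  obtain ⟨b, hb⟩ := hE.nonempty _ (hE.compl_mem B hB)
  refine ((hE.finite_initialSet_notMem hA a).union (hE.finite_initialSet_notMem hA b)).subset ?_
  rintro C ⟨hC, hC'⟩
  rcases ((hE.isOrientation_initialSet hB).notMem_iff hC.1).1 hC' with ⟨-, h | h⟩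
  · exact Or.inl ⟨hC, h ha⟩
  · exact Or.inr ⟨hC, h.1 hb⟩

/-- A consistent orientation is determined by any one of its minimal members. -/
theorem IsTreeSet.eq_initialSet_of_minimal (hE : IsTreeSet E) (hO : IsOrientation E O)
    (hB : B ∈ O) (hmin : ∀ C ∈ O, ¬ C ⊂ B) : O = initialSet E B := by
  have hI := hE.isOrientation_initialSet (hO.subset hB)
  refine hO.eq_of_subset hI fun C hC => ?_
  by_contra hno
  have hCE := hO.subset hC
  rcases (hI.notMem_iff hCE).1 hno with ⟨hC', h | h⟩
  · exact hO.compl_notMem C hC (hO.mem_of_subset B hB _ hC' h)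
  · exact hmin C hC (compl_lt_compl_iff_lt.1 h)

/-- If the orientation of a vertex differs from the consistent orientation `O`, then they differ
on an edge that starts at this vertex. -/
theorem IsTreeSet.exists_eq_initialSet (hE : IsTreeSet E) (hO : IsOrientation E O) (hA : A ∈ E)
    (hne : initialSet E A ≠ O) : ∃ B ∈ E, initialSet E A = initialSet E B ∧ B ∉ O := by
  have hI := hE.isOrientation_initialSet hA
  have hdiff : ∃ C ∈ initialSet E A, C ∉ O := by
    by_contra! hno
    exact hne (hI.eq_of_subset hO hno)
  obtain ⟨C, hC, hCO⟩ := hdiff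
  have hfin := hE.finite_initialSet_subset hA (hI.subset hC)
  obtain ⟨B, hB⟩ := (hfin.subset (t := {B | B ∈ initialSet E A ∧ B ⊆ C ∧ B ∉ O})
    fun B hB => ⟨hB.1, hB.2.1⟩).exists_minimal ⟨C, hC, subset_rfl, hCO⟩
  have hBE := hI.subset hB.1.1
  refine ⟨B, hBE, hE.eq_initialSet_of_minimal hI hB.1.1 fun D hD hDB => ?_, hB.1.2.2⟩
  exact hDB.2 (hB.2 ⟨hD, hDB.1.trans hB.1.2.1,
    fun h => hB.1.2.2 (hO.mem_of_subset D h B hBE hDB.1)⟩ hDB.1)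

end EdgeCut

/-! ### The structure tree -/

namespace CapGraph

open EdgeCut

variable {V : Type*} {N : CapGraph V} {n : ℕ} {A B : Set V} {u w : N.TreeVertex n}

theorem IsNetwork.isTreeSet_treeCuts (hN : N.IsNetwork) (n : ℕ) : IsTreeSet (N.treeCuts n) where
  compl_mem _ hA := hN.compl_mem_treeCuts hA
  nonempty A hA := by
    obtain ⟨m, -, ⟨p, q, h⟩, -⟩ := hN.mem_thinCuts_of_mem_treeCuts hA
    exact h.nonempty
  nested _ hA _ hB := hN.nested_of_mem_treeCuts hA hB
  finite_separating x y := (hN.finite_thinCuts_separating n x y).subset fun _ hA =>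
    ⟨hN.mem_thinCuts_of_mem_treeCuts hA.1, hA.2⟩

/-- The vertex `ι A` of the structure tree. -/
def initial (A : Set V) (hA : A ∈ N.treeCuts n) : N.TreeVertex n :=
  ⟨N.initialVertex n A, Or.inr ⟨A, hA, rfl⟩⟩

theorem IsNetwork.isOrientation (hN : N.IsNetwork) (u : N.TreeVertex n) :
    IsOrientation (N.treeCuts n) u.1 := by
  obtain ⟨O, ⟨h, rfl⟩ | ⟨A, hA, rfl⟩⟩ := u
  · constructor <;> simp [h]
  · exact (hN.isTreeSet_treeCuts n).isOrientation_initialSet hA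

theorem eq_initialVertex_of_mem (hA : A ∈ N.treeCuts n) (u : N.TreeVertex n) :
    ∃ B ∈ N.treeCuts n, u.1 = N.initialVertex n B := by
  rcases u.2 with ⟨h, -⟩ | h
  · rw [h] at hA
    exact hA.elim
  · exact h

theorem IsNetwork.finite_diff (hN : N.IsNetwork) (u w : N.TreeVertex n) : (u.1 \ w.1).Finite := by
  rcases u.2 with ⟨-, h⟩ | ⟨A, hA, h⟩
  · simp [h]
  · obtain ⟨B, hB, h'⟩ := eq_initialVertex_of_mem hA w
    rw [h, h']
    exact (hN.isTreeSet_treeCuts n).finite_initialSet_diff hA hB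

theorem IsTreeEdge.symm (hN : N.IsNetwork) (h : N.IsTreeEdge n A u w) :
    N.IsTreeEdge n Aᶜ w u :=
  ⟨hN.compl_mem_treeCuts h.1, h.2.2, by rw [compl_compl]; exact h.2.1⟩

theorem IsTreeEdge.mem (h : N.IsTreeEdge n A u w) : A ∈ u.1 := by
  rw [h.2.1]
  exact mem_initialSet_self h.1

theorem IsTreeEdge.notMem (hN : N.IsNetwork) (h : N.IsTreeEdge n A u w) : A ∉ w.1 := by
  rw [h.2.2]
  have := (hN.isTreeSet_treeCuts n).compl_notMem_initialSet (hN.compl_mem_treeCuts h.1)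
  rwa [compl_compl] at this

/-- Across an edge, all cuts but the one of that edge keep their orientation. -/
theorem IsTreeEdge.mem_of_mem (hN : N.IsNetwork) (h : N.IsTreeEdge n A u w) (hB : B ∈ u.1)
    (hBA : B ≠ A) : B ∈ w.1 := by
  by_cases hBA' : B = Aᶜ
  · exact hBA' ▸ (h.symm hN).mem
  · rw [h.2.1] at hB
    rw [h.2.2]
    exact (mem_initialSet_compl hBA hBA').2 hB

theorem IsTreeEdge.eq_of_mem (hN : N.IsNetwork) (h : N.IsTreeEdge n A u w) (hB : B ∈ u.1)
    (hB' : B ∉ w.1) : B = A := by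
  by_contra hBA
  exact hB' (h.mem_of_mem hN hB hBA)

theorem IsTreeEdge.adj (hN : N.IsNetwork) (h : N.IsTreeEdge n A u w) :
    (N.structureTree n).graph.Adj u w := by
  refine (SimpleGraph.fromRel_adj _ _ _).2 ⟨?_, Or.inl ⟨A, h⟩⟩
  rintro rfl
  exact h.notMem hN h.mem

theorem IsNetwork.exists_isTreeEdge (hN : N.IsNetwork) (h : (N.structureTree n).graph.Adj u w) :
    ∃ A, N.IsTreeEdge n A u w := by
  rcases ((SimpleGraph.fromRel_adj _ _ _).1 h).2 with h | ⟨A, h⟩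
  · exact h
  · exact ⟨Aᶜ, h.symm hN⟩

theorem exists_isTreeEdge_of_mem (hN : N.IsNetwork) (hA : A ∈ N.treeCuts n) :
    ∃ u w, N.IsTreeEdge n A u w :=
  ⟨initial A hA, initial Aᶜ (hN.compl_mem_treeCuts hA), hA, rfl, rfl⟩

theorem IsTreeEdge.eq_ends {u' w' : N.TreeVertex n} (h : N.IsTreeEdge n A u w)
    (h' : N.IsTreeEdge n A u' w') : u = u' ∧ w = w' :=
  ⟨Subtype.ext (h.2.1.trans h'.2.1.symm), Subtype.ext (h.2.2.trans h'.2.2.symm)⟩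

/-- If a vertex of the structure tree does not induce the consistent orientation `O`, then some edge
leaves this vertex towards `O`. -/
theorem IsNetwork.exists_isTreeEdge_towards (hN : N.IsNetwork) {O : Set (Set V)}
    (hO : IsOrientation (N.treeCuts n) O) (u : N.TreeVertex n) (hne : u.1 ≠ O) :
    ∃ A w, N.IsTreeEdge n A u w ∧ A ∉ O := by
  rcases u.2 with ⟨h, h'⟩ | ⟨A, hA, h⟩
  · exact absurd (Set.subset_empty_iff.1 (h ▸ hO.subset)) (fun h => hne (h'.trans h.symm))
  · rw [h] at hne
    obtain ⟨B, hB, h1, h2⟩ := (hN.isTreeSet_treeCuts n).exists_eq_initialSet hO hA hne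
    exact ⟨B, initial Bᶜ (hN.compl_mem_treeCuts hB), ⟨hB, h.trans h1, rfl⟩, h2⟩

/-- If a set `S` of vertices separates `u` from `w`, then its boundary contains an edge that itself
separates `u` from `w`: walk from `u` to `w`, reversing one cut of the finite difference at a
time. -/
theorem IsNetwork.exists_isTreeEdge_boundary (hN : N.IsNetwork) (S : Set (N.TreeVertex n))
    (hu : u ∈ S) (hw : w ∉ S) :
    ∃ A p q, N.IsTreeEdge n A p q ∧ p ∈ S ∧ q ∉ S ∧ A ∈ u.1 ∧ A ∉ w.1 := by
  induction hk : (u.1 \ w.1).ncard using Nat.strong_induction_on generalizing u with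
  | _ k ih =>
    have hne : u.1 ≠ w.1 := fun h => hw (Subtype.ext h ▸ hu)
    obtain ⟨A, v, hA, hAw⟩ := hN.exists_isTreeEdge_towards (hN.isOrientation w) u hne
    by_cases hv : v ∈ S
    · have hss : v.1 \ w.1 ⊂ u.1 \ w.1 := by
        refine (Set.ssubset_iff_of_subset ?_).2 ⟨A, ⟨hA.mem, hAw⟩, fun h => hA.notMem hN h.1⟩
        rintro B ⟨hB, hBw⟩
        refine ⟨(hA.symm hN).mem_of_mem hN hB ?_, hBw⟩
        rintro rfl
        exact hBw (((hN.isOrientation w).notMem_iff hA.1).1 hAw)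
      obtain ⟨B, p, q, h1, h2, h3, h4, h5⟩ :=
        ih _ (hk ▸ Set.ncard_lt_ncard hss (hN.finite_diff u w)) hv rfl
      exact ⟨B, p, q, h1, h2, h3, (hss.subset ⟨h4, h5⟩).1, h5⟩
    · exact ⟨A, u, v, hA, hu, hv, hA.mem, hAw⟩

theorem IsNetwork.isTreeEdge_of_adj (hN : N.IsNetwork) (h : (N.structureTree n).graph.Adj u w)
    (hu : A ∈ u.1) (hw : A ∉ w.1) : N.IsTreeEdge n A u w := by
  obtain ⟨B, hB⟩ := hN.exists_isTreeEdge h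
  exact hB.eq_of_mem hN hu hw ▸ hB

/-- The side of an edge of the tree is bounded by this edge alone. -/
theorem IsNetwork.isCut_treeSide (hN : N.IsNetwork) (n : ℕ) (A : Set V) :
    IsCut (N.structureTree n).graph (N.treeSide n A) := by
  refine Set.Subsingleton.finite ?_
  rintro _ ⟨he, u, hu, w, hw, rfl⟩ _ ⟨he', u', hu', w', hw', rfl⟩
  obtain ⟨rfl, rfl⟩ := (hN.isTreeEdge_of_adj he hu hw).eq_ends (hN.isTreeEdge_of_adj he' hu' hw')
  rfl

theorem IsNetwork.connected_structureTree (hN : N.IsNetwork) (n : ℕ) :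
    (N.structureTree n).graph.Connected := by
  have hne : Nonempty (N.TreeVertex n) := by
    rcases (N.treeCuts n).eq_empty_or_nonempty with h | ⟨A, hA⟩
    · exact ⟨⟨∅, Or.inl ⟨h, rfl⟩⟩⟩
    · exact ⟨initial A hA⟩
  refine { preconnected := fun u w => ?_, nonempty := hne }
  by_contra hno
  obtain ⟨A, p, q, h, hp, hq, -⟩ := hN.exists_isTreeEdge_boundary
    {v | (N.structureTree n).graph.Reachable u v} (SimpleGraph.Reachable.refl u) hno
  exact hq (SimpleGraph.Reachable.trans hp (h.adj hN).reachable)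

theorem IsNetwork.isTree_structureTree (hN : N.IsNetwork) (n : ℕ) :
    (N.structureTree n).graph.IsTree := by
  refine ⟨hN.connected_structureTree n, ?_⟩
  rw [SimpleGraph.isAcyclic_iff_forall_adj_isBridge]
  intro u w huw
  obtain ⟨A, hA⟩ := hN.exists_isTreeEdge huw
  rw [SimpleGraph.isBridge_iff]
  rintro ⟨p⟩
  obtain ⟨d, -, hd1, hd2⟩ := p.exists_boundary_dart (N.treeSide n A) hA.mem (hA.notMem hN)
  have hd := SimpleGraph.deleteEdges_adj.1 d.adj
  obtain ⟨h1, h2⟩ := (hN.isTreeEdge_of_adj hd.1 hd1 hd2).eq_ends hA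
  refine hd.2 ?_
  rw [h1, h2]
  rfl

theorem IsTreeEdge.cap_eq (hN : N.IsNetwork) (h : N.IsTreeEdge n A u w) :
    (N.structureTree n).cap ⟨s(u, w), h.adj hN⟩ = N.capacity A := by
  have : {k | ∃ B u' w', N.IsTreeEdge n B u' w' ∧ s(u, w) = s(u', w') ∧ k = N.capacity B} =
      {N.capacity A} := by
    ext k
    constructor
    · rintro ⟨B, u', w', hB, he, rfl⟩
      rcases Sym2.eq_iff.1 he with ⟨rfl, rfl⟩ | ⟨rfl, rfl⟩
      · rw [hB.eq_of_mem hN h.mem (h.notMem hN)]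
        rfl
      · rw [(hB.symm hN).eq_of_mem hN h.mem (h.notMem hN), capacity_compl]
        rfl
    · rintro rfl
      exact ⟨A, u, w, h, rfl, rfl⟩
  exact (congrArg sInf this).trans (csInf_singleton _)

theorem IsNetwork.structureTree_isNetwork (hN : N.IsNetwork) (n : ℕ) :
    (N.structureTree n).IsNetwork := by
  refine ⟨hN.connected_structureTree n, ?_⟩
  rintro ⟨e, he⟩
  induction e with
  | _ u w =>
    obtain ⟨A, hA⟩ := hN.exists_isTreeEdge he
    rw [hA.cap_eq hN]
    obtain ⟨m, -, ⟨p, q, h⟩, -⟩ := hN.mem_thinCuts_of_mem_treeCuts hA.1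
    exact hN.capacity_pos h.1 h.nonempty h.compl.nonempty

end CapGraph

/-! ### The points of the structure tree -/

namespace CapGraph

open EdgeCut

variable {V : Type*} {N : CapGraph V} {n : ℕ} {A B : Set V}

/-- Every consistent orientation of `ℰₙ` comes from a point of the structure tree. Unless it comes
from a vertex, a walk that always follows an edge towards the orientation is a ray that converges
to it. -/
theorem IsNetwork.exists_point_of_isOrientation (hN : N.IsNetwork) {O : Set (Set V)}
    (hO : IsOrientation (N.treeCuts n) O) :
    ∃ t : Point (N.structureTree n).graph, ∀ A ∈ N.treeCuts n,
      (t.LiesIn (N.treeSide n A) ↔ A ∈ O) := by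
  by_cases hv : ∃ u : N.TreeVertex n, u.1 = O
  · obtain ⟨u, rfl⟩ := hv
    exact ⟨Sum.inl u, fun A _ => Iff.rfl⟩
  push Not at hv
  choose F next hF hFO using fun u : N.TreeVertex n => hN.exists_isTreeEdge_towards hO u (hv u)
  obtain ⟨u₀⟩ := (hN.connected_structureTree n).nonempty
  let r : ℕ → N.TreeVertex n := fun i => Nat.rec u₀ (fun _ u => next u) i
  have hr : ∀ i, N.IsTreeEdge n (F (r i)) (r i) (r (i + 1)) := fun i => hF (r i)
  -- a cut that has the orientation given by `O` at some time keeps it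
  have keep : ∀ A ∈ O, ∀ i j, i ≤ j → A ∈ (r i).1 → A ∈ (r j).1 := by
    intro A hA i j hij hi
    induction j, hij using Nat.le_induction with
    | base => exact hi
    | succ j _ ih => exact (hr j).mem_of_mem hN ih fun h => hFO (r j) (h ▸ hA)
  have hFc : ∀ i, (F (r i))ᶜ ∈ O := fun i => (hO.notMem_iff (hr i).1).1 (hFO (r i))
  have hlater : ∀ i j, i < j → F (r i) ∉ (r j).1 := fun i j hij =>
    ((hN.isOrientation (r j)).notMem_iff (hr i).1).2
      (keep _ (hFc i) (i + 1) j hij ((hr i).symm hN).mem)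
  have hinj : Function.Injective (fun i => F (r i)) := by
    refine Function.Injective.of_lt_imp_ne fun i j hij h => hlater i j hij ?_
    rw [show F (r i) = F (r j) from h]
    exact (hr j).mem
  let ρ : Ray (N.structureTree n).graph :=
    { toFun := r
      injective := Function.Injective.of_lt_imp_ne fun i j hij h => hlater i j hij (h ▸ (hr i).mem)
      adj := fun i => (hr i).adj hN }
  -- if `A ∈ O` were never reached, infinitely many members of `r 0` would lie inside `Aᶜ`
  have conv : ∀ A ∈ O, ∃ k, ∀ i, k ≤ i → A ∈ (r i).1 := by
    intro A hA
    by_contra hno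
    have hnever : ∀ i, A ∉ (r i).1 := fun i hi => hno ⟨i, fun j hij => keep A hA i j hij hi⟩
    have hAE := hO.subset hA
    obtain ⟨B, hB, hB0⟩ := eq_initialVertex_of_mem hAE (r 0)
    have hfin := (hN.isTreeSet_treeCuts n).finite_initialSet_subset hB (hN.compl_mem_treeCuts hAE)
    refine Set.infinite_range_of_injective hinj (hfin.subset ?_)
    rintro _ ⟨i, rfl⟩
    constructor
    · have h0 : F (r i) ∈ (r 0).1 := by
        by_contra h
        have := ((hN.isOrientation (r 0)).notMem_iff (hr i).1).1 h
        exact (hN.isOrientation (r i)).compl_notMem _ (hr i).mem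
          (keep _ (hFc i) 0 i (Nat.zero_le i) this)
      rw [hB0] at h0
      exact h0
    · have hi := ((hN.isOrientation (r i)).notMem_iff hAE).1 (hnever i)
      rw [(hr i).2.1] at hi
      rcases hi.2 with h | h
      · exact h
      · exact absurd (hO.mem_of_subset _ (hFc i) _ (hN.compl_mem_treeCuts hAE) h.1)
          (hO.compl_notMem A hA)
  refine ⟨Sum.inr (Quotient.mk (raySetoid _) ρ), fun A hA => ?_⟩
  rw [Point.liesIn_mk (hN.isCut_treeSide n A)]
  constructor
  · intro h
    by_contra hAO
    obtain ⟨k, hk⟩ := conv _ ((hO.notMem_iff hA).1 hAO)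
    refine ρ.not_eventuallyIn_both h ⟨k, fun i hi => ?_⟩
    exact ((hN.isOrientation (r i)).notMem_iff hA).2 (hk i hi)
  · exact fun h => conv A h

/-- A ray of the tree traverses each of its edges only once. -/
theorem IsNetwork.mem_ray_iff (hN : N.IsNetwork) (r : Ray (N.structureTree n).graph) {i : ℕ}
    (h : N.IsTreeEdge n A (r.toFun i) (r.toFun (i + 1))) (j : ℕ) :
    A ∈ (r.toFun j).1 ↔ j ≤ i := by
  have hne : ∀ j, j ≠ i → (A ∈ (r.toFun j).1 ↔ A ∈ (r.toFun (j + 1)).1) := by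
    intro j hj
    constructor
    · intro h1
      by_contra h2
      exact hj (r.injective ((hN.isTreeEdge_of_adj (r.adj j) h1 h2).eq_ends h).1)
    · intro h1
      by_contra h2
      obtain ⟨e1, e2⟩ := (hN.isTreeEdge_of_adj (r.adj j).symm h1 h2).eq_ends h
      have := r.injective e1
      have := r.injective e2
      omega
  constructor
  · intro hj
    by_contra hlt
    have : ∀ j, i + 1 ≤ j → A ∉ (r.toFun j).1 := by
      intro j hij
      induction j, hij using Nat.le_induction with
      | base => exact h.notMem hN
      | succ j hij ih => rwa [← hne j (by omega)]
    exact this j (by omega) hj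
  · intro hj
    induction hj using Nat.decreasingInduction with
    | self => exact h.mem
    | of_succ k hk ih => exact (hne k (by omega)).2 ih

/-- No end of the tree lies on the same side of all edges as a given vertex. -/
theorem IsNetwork.vertex_ne_end (hN : N.IsNetwork) (u : N.TreeVertex n)
    (r : Ray (N.structureTree n).graph)
    (h : ∀ A ∈ N.treeCuts n, (A ∈ u.1 ↔ r.EventuallyIn (N.treeSide n A))) : False := by
  choose F hF using fun i => hN.exists_isTreeEdge (r.adj i)
  have hinj : Function.Injective F := Function.Injective.of_lt_imp_ne fun i j hij he => by
    have h1 := (hN.mem_ray_iff r (hF i) j).1 (he ▸ (hF j).mem)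
    omega
  -- all edges of the ray point away from `u`, hence are members of a finite difference
  refine Set.infinite_range_of_injective hinj ((hN.finite_diff (r.toFun 0) u).subset ?_)
  rintro _ ⟨i, rfl⟩
  refine ⟨(hN.mem_ray_iff r (hF i) 0).2 (Nat.zero_le i), fun hu => ?_⟩
  obtain ⟨k, hk⟩ := (h _ (hF i).1).1 hu
  have h1 := (hN.mem_ray_iff r (hF i) _).1 (hk (max k (i + 1)) (le_max_left _ _))
  have h2 := le_max_right k (i + 1)
  omega

/-- Rays of the tree that are separated by some cut are separated by some edge. -/
theorem IsNetwork.not_separatesRays (hN : N.IsNetwork) (r r' : Ray (N.structureTree n).graph)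
    (h : ∀ A ∈ N.treeCuts n, (r.EventuallyIn (N.treeSide n A) ↔
      r'.EventuallyIn (N.treeSide n A))) {S : Set (N.TreeVertex n)}
    (hS : IsCut (N.structureTree n).graph S) (hr : r.EventuallyIn S) (hr' : r'.EventuallyIn Sᶜ) :
    False := by
  have hfin : {A | ∃ u w, N.IsTreeEdge n A u w ∧
      s(u, w) ∈ boundary (N.structureTree n).graph S}.Finite := by
    have : {A | ∃ u w, N.IsTreeEdge n A u w ∧ s(u, w) ∈ boundary (N.structureTree n).graph S} ⊆
        ⋃ e ∈ boundary (N.structureTree n).graph S, {A | ∃ u w, N.IsTreeEdge n A u w ∧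
          s(u, w) = e} := by
      rintro A ⟨u, w, h, he⟩
      exact Set.mem_biUnion he ⟨u, w, h, rfl⟩
    refine (Set.Finite.biUnion hS fun e he => ?_).subset this
    induction e with
    | _ u w =>
      obtain ⟨B, hB⟩ := hN.exists_isTreeEdge he.1
      refine (Set.toFinite {B, Bᶜ}).subset ?_
      rintro A ⟨u', w', hA, he⟩
      rcases Sym2.eq_iff.1 he with ⟨rfl, rfl⟩ | ⟨rfl, rfl⟩
      · exact Or.inl (hB.eq_of_mem hN hA.mem (hA.notMem hN))
      · exact Or.inr ((hB.symm hN).eq_of_mem hN hA.mem (hA.notMem hN))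
  have hev : ∀ A ∈ {A | ∃ u w, N.IsTreeEdge n A u w ∧
      s(u, w) ∈ boundary (N.structureTree n).graph S},
      ∀ᶠ i in Filter.atTop, (A ∈ (r.toFun i).1 → A ∈ (r'.toFun i).1) := by
    rintro A ⟨u, w, hA, -⟩
    rw [Filter.eventually_atTop]
    rcases r'.eventuallyIn_or (hN.isCut_treeSide n A) with h' | h'
    · obtain ⟨k, hk⟩ := h'
      exact ⟨k, fun i hi _ => hk i hi⟩
    · obtain ⟨k, hk⟩ := (r.eventuallyIn_or (hN.isCut_treeSide n A)).resolve_left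
        fun h1 => r'.not_eventuallyIn_both ((h A hA.1).1 h1) h'
      exact ⟨k, fun i hi h1 => absurd h1 (hk i hi)⟩
  obtain ⟨k, hk⟩ := Filter.eventually_atTop.1 ((Filter.eventually_all_finite hfin).2 hev)
  obtain ⟨l, hl⟩ := hr
  obtain ⟨m, hm⟩ := hr'
  obtain ⟨A, p, q, hA, hp, hq, h1, h2⟩ := hN.exists_isTreeEdge_boundary S
    (hl (max k (max l m)) (by omega)) (hm (max k (max l m)) (by omega))
  exact h2 (hk _ (le_max_left _ _) A
    ⟨p, q, hA, mk_mem_boundary.2 ⟨hA.adj hN, Or.inl ⟨hp, hq⟩⟩⟩ h1)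

/-- A point of the structure tree is determined by the sides of the edges in which it lies. -/
theorem IsNetwork.point_ext (hN : N.IsNetwork) {t t' : Point (N.structureTree n).graph}
    (h : ∀ A ∈ N.treeCuts n, (t.LiesIn (N.treeSide n A) ↔ t'.LiesIn (N.treeSide n A))) :
    t = t' := by
  have hcut := hN.isCut_treeSide n
  rcases t with u | ω <;> rcases t' with u' | ω'
  · refine congrArg Sum.inl (Subtype.ext (Set.ext fun A => ?_))
    constructor
    · exact fun hA => (h A ((hN.isOrientation u).subset hA)).1 hA
    · exact fun hA => (h A ((hN.isOrientation u').subset hA)).2 hA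
  · induction ω' using Quotient.inductionOn with
    | _ r =>
      exact (hN.vertex_ne_end u r fun A hA => (h A hA).trans (Point.liesIn_mk (hcut A) r)).elim
  · induction ω using Quotient.inductionOn with
    | _ r =>
      exact (hN.vertex_ne_end u' r fun A hA =>
        (h A hA).symm.trans (Point.liesIn_mk (hcut A) r)).elim
  · induction ω using Quotient.inductionOn with
    | _ r =>
      induction ω' using Quotient.inductionOn with
      | _ r' =>
        have hrr : ∀ A ∈ N.treeCuts n, (r.EventuallyIn (N.treeSide n A) ↔
            r'.EventuallyIn (N.treeSide n A)) := fun A hA =>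
          (Point.liesIn_mk (hcut A) r).symm.trans ((h A hA).trans (Point.liesIn_mk (hcut A) r'))
        refine congrArg Sum.inr (Quotient.sound fun S hS hs => ?_)
        rcases hs with hs | hs
        · exact hN.not_separatesRays r r' hrr hS hs.1 hs.2
        · exact hN.not_separatesRays r' r (fun A hA => (hrr A hA).symm) hS hs.2 hs.1

/-- The cuts of `ℰₙ` that contain a given point form a consistent orientation. -/
theorem IsNetwork.isOrientation_point (hN : N.IsNetwork) (n : ℕ) (p : Point N.graph) :
    IsOrientation (N.treeCuts n) {A | A ∈ N.treeCuts n ∧ p.LiesIn A} := by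
  have hcut : ∀ A ∈ N.treeCuts n, IsCut N.graph A := fun A hA => by
    obtain ⟨m, -, h⟩ := hN.mem_thinCuts_of_mem_treeCuts hA
    exact isCut_of_mem_thinCuts h
  refine ⟨fun A hA => hA.1, fun A hA => ?_, fun A hA hA' => ?_, fun A hA B hB hAB => ?_⟩
  · by_cases h : p.LiesIn A
    · exact Or.inl ⟨hA, h⟩
    · exact Or.inr ⟨hN.compl_mem_treeCuts hA, (Point.liesIn_compl (hcut A hA) p).2 h⟩
  · exact (Point.liesIn_compl (hcut A hA.1) p).1 hA'.2 hA.2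
  · exact ⟨hB, hA.2.mono hAB⟩

theorem IsNetwork.exists_isStructureMap (hN : N.IsNetwork) (n : ℕ) :
    ∃ ν, N.IsStructureMap n ν := by
  choose ν hν using fun p => hN.exists_point_of_isOrientation (hN.isOrientation_point n p)
  exact ⟨ν, fun A hA p => (hν p A hA).trans (and_iff_right hA)⟩

theorem IsStructureMap.unique (hN : N.IsNetwork)
    {ν ν' : Point N.graph → Point (N.structureTree n).graph}
    (hν : N.IsStructureMap n ν) (hν' : N.IsStructureMap n ν') : ν' = ν :=
  funext fun p => hN.point_ext fun A hA => (hν' A hA p).trans (hν A hA p).symm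

/-- A vertex `x` is mapped to a vertex: only finitely many cuts of `ℰₙ` that contain `x` lie inside
one of them, so that there is a minimal one. -/
theorem IsStructureMap.exists_eq_inl (hN : N.IsNetwork)
    {ν : Point N.graph → Point (N.structureTree n).graph}
    (hν : N.IsStructureMap n ν) (x : V) : ∃ w : N.TreeVertex n, ν (Sum.inl x) = Sum.inl w := by
  have hO := hN.isOrientation_point n (Sum.inl x)
  suffices h : ∃ w : N.TreeVertex n, w.1 = {A | A ∈ N.treeCuts n ∧
      Point.LiesIn A (Sum.inl x : Point N.graph)} by
    obtain ⟨w, hw⟩ := h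
    refine ⟨w, hN.point_ext fun A hA => (hν A hA _).trans ?_⟩
    change _ ↔ A ∈ w.1
    rw [hw]
    exact (and_iff_right hA).symm
  have hE := hN.isTreeSet_treeCuts n
  rcases (N.treeCuts n).eq_empty_or_nonempty with h | ⟨A₀, hA₀⟩
  · exact ⟨⟨∅, Or.inl ⟨h, rfl⟩⟩, (Set.subset_empty_iff.1 (h ▸ hO.subset)).symm⟩
  obtain ⟨A, hA⟩ : ∃ A, A ∈ {A | A ∈ N.treeCuts n ∧
      Point.LiesIn A (Sum.inl x : Point N.graph)} := by
    rcases hO.mem_or A₀ hA₀ with h | h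
    exacts [⟨_, h⟩, ⟨_, h⟩]
  obtain ⟨y, hy⟩ := hE.nonempty _ (hN.compl_mem_treeCuts hA.1)
  obtain ⟨B, hB⟩ := ((hE.finite_separating x y).subset
    (t := {B | B ∈ N.treeCuts n ∧ x ∈ B ∧ B ⊆ A})
    fun B hB => ⟨hB.1, hB.2.1, fun h => hy (hB.2.2 h)⟩).exists_minimal ⟨A, hA.1, hA.2, subset_rfl⟩
  refine ⟨initial B hB.1.1, (hE.eq_initialSet_of_minimal hO ⟨hB.1.1, hB.1.2.1⟩ ?_).symm⟩
  intro C hC hCB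
  exact hCB.2 (hB.2 ⟨hC.1, hC.2, hCB.1.trans hB.1.2.2⟩ hCB.1)

theorem IsStructureMap.eq_iff (hN : N.IsNetwork)
    {ν : Point N.graph → Point (N.structureTree n).graph}
    (hν : N.IsStructureMap n ν) (p q : Point N.graph) :
    ν p = ν q ↔ ¬ ∃ A, IsCut N.graph A ∧ N.capacity A ≤ n ∧ Separates A p q := by
  constructor
  · intro h hs
    obtain ⟨A, hA, hs⟩ := hN.exists_mem_treeCuts_separates hs
    obtain ⟨m, -, ht⟩ := hN.mem_thinCuts_of_mem_treeCuts hA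
    rw [separates_iff (isCut_of_mem_thinCuts ht), ← hν A hA p, ← hν A hA q, h] at hs
    tauto
  · intro h
    refine hN.point_ext fun A hA => ?_
    rw [hν A hA p, hν A hA q]
    by_contra hs
    obtain ⟨m, hm, ht⟩ := hN.mem_thinCuts_of_mem_treeCuts hA
    refine h ⟨A, isCut_of_mem_thinCuts ht, ht.2.trans_le hm, ?_⟩
    rw [separates_iff (isCut_of_mem_thinCuts ht)]
    tauto

end CapGraph

/-! ### Isomorphisms of networks -/

namespace EdgeCut

variable {V W : Type*} {G : SimpleGraph V} {H : SimpleGraph W} {A B : Set V}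

theorem map_mem_boundary_image (φ : G ≃g H) (e : Sym2 V) :
    Sym2.map φ e ∈ boundary H (φ '' A) ↔ e ∈ boundary G A := by
  induction e with
  | _ x y =>
    rw [Sym2.map_mk, mk_mem_boundary, mk_mem_boundary]
    simp only [φ.map_adj_iff, φ.injective.mem_set_image]

theorem IsCut.image (φ : G ≃g H) (hA : IsCut G A) : IsCut H (φ '' A) := by
  have h : φ '' A = φ.symm ⁻¹' A := φ.toEquiv.image_eq_preimage_symm A
  rw [h]
  exact hA.preimage φ.symm

theorem IsCut.of_image (φ : G ≃g H) (hA : IsCut H (φ '' A)) : IsCut G A := by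
  have := hA.preimage φ
  rwa [Set.preimage_image_eq _ φ.injective] at this

theorem Point.map_surjective (φ : G ≃g H) : Function.Surjective (Point.map φ) := by
  rintro (y | ω)
  · exact ⟨Sum.inl (φ.symm y), congrArg Sum.inl (φ.apply_symm_apply y)⟩
  · induction ω using Quotient.inductionOn with
    | _ r =>
      refine ⟨Sum.inr (Quotient.mk _ (r.map φ.symm)), congrArg Sum.inr ?_⟩
      refine congrArg (Quotient.mk (raySetoid H)) ?_
      obtain ⟨f, hf, hf'⟩ := r
      simp only [Ray.map, RelIso.apply_symm_apply]

theorem Point.map_liesIn_image (φ : G ≃g H) (hA : IsCut G A) (p : Point G) :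
    (Point.map φ p).LiesIn (φ '' A) ↔ p.LiesIn A := by
  rcases p with x | ω
  · exact φ.injective.mem_set_image
  · induction ω using Quotient.inductionOn with
    | _ r =>
      refine (Point.liesIn_mk (hA.image φ) (r.map φ)).trans
        (Iff.trans ?_ (Point.liesIn_mk hA r).symm)
      simp only [Ray.EventuallyIn, Ray.map, φ.injective.mem_set_image]

theorem separates_image (φ : G ≃g H) (hA : IsCut G A) (p q : Point G) :
    Separates (φ '' A) (Point.map φ p) (Point.map φ q) ↔ Separates A p q := by
  rw [separates_iff (hA.image φ), separates_iff hA, Point.map_liesIn_image φ hA,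
    Point.map_liesIn_image φ hA]

theorem nested_image {f : V → W} (hf : Function.Bijective f) :
    Nested (f '' A) (f '' B) ↔ Nested A B := by
  simp only [Nested, ← Set.image_compl_eq hf, ← Set.image_inter hf.injective,
    Set.image_eq_empty]

theorem crossingNumber_image {f : V → W} (hf : Function.Bijective f) {D : Set (Set V)}
    {D' : Set (Set W)} (hD : ∀ B, f '' B ∈ D' ↔ B ∈ D) (A : Set V) :
    crossingNumber (f '' A) D' = crossingNumber A D := by
  have h : {B' | B' ∈ D' ∧ ¬ Nested (f '' A) B'} =
      (Set.image f) '' {B | B ∈ D ∧ ¬ Nested A B} := by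
    ext B'
    obtain ⟨B, rfl⟩ := (Set.image_surjective.2 hf.surjective) B'
    rw [(Set.image_injective.2 hf.injective).mem_set_image]
    simp only [Set.mem_ofPred_eq, hD, nested_image hf]
  rw [crossingNumber, h, (Set.image_injective.2 hf.injective).encard_image, crossingNumber]

end EdgeCut

namespace CapGraph

open EdgeCut

variable {V W : Type*} {N : CapGraph V} {M : CapGraph W} {n : ℕ} {A : Set V}

namespace Iso

theorem image_surjective (φ : N.Iso M) :
    Function.Surjective (fun A : Set V => φ.toIso '' A) :=
  Set.image_surjective.2 φ.toIso.surjective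

theorem image_compl (φ : N.Iso M) (A : Set V) : φ.toIso '' Aᶜ = (φ.toIso '' A)ᶜ :=
  Set.image_compl_eq φ.toIso.bijective

/-- The inverse of an isomorphism of networks. -/
def symm (φ : N.Iso M) : M.Iso N where
  toIso := φ.toIso.symm
  cap_eq e := by
    rw [← φ.cap_eq]
    congr 1
    exact φ.toIso.mapEdgeSet.apply_symm_apply e

theorem symm_image_image (φ : N.Iso M) (A : Set V) :
    φ.symm.toIso '' (φ.toIso '' A) = A :=
  φ.toIso.toEquiv.symm_image_image A

theorem image_symm_image (φ : N.Iso M) (A : Set W) :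
    φ.toIso '' (φ.symm.toIso '' A) = A :=
  φ.toIso.toEquiv.image_symm_image A

theorem capacity_image (φ : N.Iso M) (A : Set V) :
    M.capacity (φ.toIso '' A) = N.capacity A := by
  unfold capacity
  rw [← finsum_comp_equiv φ.toIso.mapEdgeSet]
  refine finsum_congr fun e => ?_
  rw [φ.cap_eq]
  exact finsum_congr_Prop (propext (map_mem_boundary_image φ.toIso (e : Sym2 V))) fun _ => rfl

theorem isThinFor_image (φ : N.Iso M) (p q : Point N.graph) :
    M.IsThinFor (φ.toIso '' A) (Point.map φ.toIso p) (Point.map φ.toIso q) ↔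
      N.IsThinFor A p q := by
  constructor
  · rintro ⟨h1, h2, h3⟩
    have h1' := h1.of_image φ.toIso
    refine ⟨h1', (separates_image φ.toIso h1' p q).1 h2, fun B hB hs => ?_⟩
    have := h3 _ (hB.image φ.toIso) ((separates_image φ.toIso hB p q).2 hs)
    rwa [φ.capacity_image, φ.capacity_image] at this
  · rintro ⟨h1, h2, h3⟩
    refine ⟨h1.image φ.toIso, (separates_image φ.toIso h1 p q).2 h2, fun B' hB' hs => ?_⟩
    obtain ⟨B, rfl⟩ := φ.image_surjective B'
    have hB := hB'.of_image φ.toIso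
    have := h3 _ hB ((separates_image φ.toIso hB p q).1 hs)
    rwa [φ.capacity_image, φ.capacity_image]

theorem image_mem_thinCuts (φ : N.Iso M) :
    φ.toIso '' A ∈ M.thinCuts n ↔ A ∈ N.thinCuts n := by
  refine and_congr ?_ (by rw [φ.capacity_image])
  simp only [(Point.map_surjective φ.toIso).exists, φ.isThinFor_image]

theorem image_mem_optimallyNested (φ : N.Iso M) {D : Set (Set V)} {D' : Set (Set W)}
    (hD : ∀ B, φ.toIso '' B ∈ D' ↔ B ∈ D) :
    φ.toIso '' A ∈ M.optimallyNested D' ↔ A ∈ N.optimallyNested D := by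
  refine and_congr (hD A) ?_
  simp only [(Point.map_surjective φ.toIso).exists, φ.isThinFor_image,
    φ.image_surjective.forall, hD, crossingNumber_image φ.toIso.bijective hD]

theorem image_mem_treeCuts (φ : N.Iso M) :
    φ.toIso '' A ∈ M.treeCuts n ↔ A ∈ N.treeCuts n := by
  induction n using Nat.twoStepInduction generalizing A with
  | zero => exact Iff.rfl
  | one => exact φ.image_mem_thinCuts
  | more n _ ih =>
    refine or_congr ih (φ.image_mem_optimallyNested fun B => and_congr φ.image_mem_thinCuts ?_)
    rw [crossingNumber_image φ.toIso.bijective fun B => ih]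

theorem image_initialVertex (φ : N.Iso M) (n : ℕ) (A : Set V) :
    (fun B => φ.toIso '' B) '' N.initialVertex n A = M.initialVertex n (φ.toIso '' A) := by
  ext B'
  obtain ⟨B, rfl⟩ := φ.image_surjective B'
  rw [(Set.image_injective.2 φ.toIso.injective).mem_set_image]
  simp only [initialVertex, Set.mem_ofPred_eq, φ.image_mem_treeCuts, ← φ.image_compl,
    Set.image_subset_image_iff φ.toIso.injective, ssubset_iff_subset_not_subset]

/-- The map that an isomorphism of networks induces on the vertices of the structure trees. -/
def mapVertex (φ : N.Iso M) (n : ℕ) (w : N.TreeVertex n) : M.TreeVertex n :=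
  ⟨(fun A => φ.toIso '' A) '' w.1, by
    rcases w.2 with ⟨h1, h2⟩ | ⟨A, hA, h⟩
    · refine Or.inl ⟨Set.eq_empty_iff_forall_notMem.2 fun B' hB' => ?_, by rw [h2, Set.image_empty]⟩
      obtain ⟨B, rfl⟩ := φ.image_surjective B'
      exact (h1 ▸ φ.image_mem_treeCuts.1 hB' : B ∈ (∅ : Set (Set V)))
    · exact Or.inr ⟨φ.toIso '' A, φ.image_mem_treeCuts.2 hA, by rw [h, φ.image_initialVertex]⟩⟩

theorem isTreeEdge_mapVertex (φ : N.Iso M) (u w : N.TreeVertex n) :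
    M.IsTreeEdge n (φ.toIso '' A) (φ.mapVertex n u) (φ.mapVertex n w) ↔
      N.IsTreeEdge n A u w := by
  have hinj := Set.image_injective.2 (Set.image_injective.2 φ.toIso.injective)
  refine and_congr φ.image_mem_treeCuts (and_congr ?_ ?_)
  · rw [← φ.image_initialVertex]
    exact hinj.eq_iff
  · rw [← φ.image_compl, ← φ.image_initialVertex]
    exact hinj.eq_iff

theorem mapVertex_injective (φ : N.Iso M) (n : ℕ) : Function.Injective (φ.mapVertex n) :=
  fun _ _ h => Subtype.ext (Set.image_injective.2 (Set.image_injective.2 φ.toIso.injective)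
    (congrArg Subtype.val h))

theorem symm_mapVertex_mapVertex (φ : N.Iso M) (w : N.TreeVertex n) :
    φ.symm.mapVertex n (φ.mapVertex n w) = w := by
  refine Subtype.ext ((Set.image_image _ _ _).trans ?_)
  simp only [symm_image_image, Set.image_id']

theorem mapVertex_symm_mapVertex (φ : N.Iso M) (w : M.TreeVertex n) :
    φ.mapVertex n (φ.symm.mapVertex n w) = w := by
  refine Subtype.ext ((Set.image_image _ _ _).trans ?_)
  simp only [image_symm_image, Set.image_id']

theorem mapVertex_adj_iff (φ : N.Iso M) (u w : N.TreeVertex n) :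
    (M.structureTree n).graph.Adj (φ.mapVertex n u) (φ.mapVertex n w) ↔
      (N.structureTree n).graph.Adj u w := by
  refine (SimpleGraph.fromRel_adj _ _ _).trans (Iff.trans ?_ (SimpleGraph.fromRel_adj _ _ _).symm)
  simp only [φ.image_surjective.exists, φ.isTreeEdge_mapVertex, (φ.mapVertex_injective n).ne_iff]

/-- The isomorphism of structure trees induced by an isomorphism of networks. -/
def structureTreeIso (φ : N.Iso M) (n : ℕ) :
    (N.structureTree n).graph ≃g (M.structureTree n).graph where
  toFun := φ.mapVertex n
  invFun := φ.symm.mapVertex n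
  left_inv := φ.symm_mapVertex_mapVertex
  right_inv := φ.mapVertex_symm_mapVertex
  map_rel_iff' {u w} := φ.mapVertex_adj_iff u w

theorem cap_structureTreeIso (hN : N.IsNetwork) (hM : M.IsNetwork) (φ : N.Iso M)
    (e : (N.structureTree n).graph.edgeSet) :
    (M.structureTree n).cap ((φ.structureTreeIso n).mapEdgeSet e) = (N.structureTree n).cap e := by
  obtain ⟨e, he⟩ := e
  induction e with
  | _ u w =>
    obtain ⟨A, hA⟩ := hN.exists_isTreeEdge he
    exact (((φ.isTreeEdge_mapVertex u w).2 hA).cap_eq hM).trans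
      ((φ.capacity_image A).trans (hA.cap_eq hN).symm)

theorem image_treeSide (φ : N.Iso M) (n : ℕ) (A : Set V) :
    φ.structureTreeIso n '' N.treeSide n A = M.treeSide n (φ.toIso '' A) := by
  ext w'
  obtain ⟨w, rfl⟩ := (φ.structureTreeIso n).surjective w'
  rw [(φ.structureTreeIso n).injective.mem_set_image]
  exact ((Set.image_injective.2 φ.toIso.injective).mem_set_image).symm

/-- The structure maps commute with isomorphisms: both composites send a point to a point of the
second tree that lies in the same sides of all edges. -/
theorem structureMap_comm (hN : N.IsNetwork) (hM : M.IsNetwork) (φ : N.Iso M)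
    {ν : Point N.graph → Point (N.structureTree n).graph} (hν : N.IsStructureMap n ν)
    {ν' : Point M.graph → Point (M.structureTree n).graph} (hν' : M.IsStructureMap n ν')
    (p : Point N.graph) :
    ν' (Point.map φ.toIso p) = Point.map (φ.structureTreeIso n) (ν p) := by
  refine hM.point_ext fun A' hA' => ?_
  obtain ⟨A, rfl⟩ := φ.image_surjective A'
  have hA := φ.image_mem_treeCuts.1 hA'
  obtain ⟨m, -, ht⟩ := hN.mem_thinCuts_of_mem_treeCuts hA
  rw [hν' _ hA', Point.map_liesIn_image φ.toIso (isCut_of_mem_thinCuts ht), ← hν A hA,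
    ← φ.image_treeSide, Point.map_liesIn_image _ (hN.isCut_treeSide n A)]

end Iso

end CapGraph

/-! ### The structure tree of a network -/

theorem mainTheorem2 {V : Type u} (N : CapGraph V) (hN : N.IsNetwork) (n : ℕ) (hn : 0 < n) :
    -- `N(Tₙ)` is a network based on a tree
    (N.structureTree n).IsNetwork ∧ (N.structureTree n).graph.IsTree ∧
    -- its directed edges are exactly the cuts in `ℰₙ`, with their capacities
    (∀ A ∈ N.treeCuts n, ∃ (u w : N.TreeVertex n) (h : (N.structureTree n).graph.Adj u w),
      N.IsTreeEdge n A u w ∧ (N.structureTree n).cap ⟨s(u, w), h⟩ = N.capacity A) ∧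
    (∀ u w, (N.structureTree n).graph.Adj u w → ∃! A, N.IsTreeEdge n A u w) ∧
    -- there is exactly one compatible map `ν`, and it has the stated properties
    ∃ ν : EdgeCut.Point N.graph → EdgeCut.Point (N.structureTree n).graph,
      N.IsStructureMap n ν ∧
      (∀ ν', N.IsStructureMap n ν' → ν' = ν) ∧
      (∀ x : V, ∃ w : N.TreeVertex n, ν (Sum.inl x) = Sum.inl w) ∧
      (∀ p q : EdgeCut.Point N.graph, ν p = ν q ↔
        ¬ ∃ A, EdgeCut.IsCut N.graph A ∧ N.capacity A ≤ n ∧ EdgeCut.Separates A p q) ∧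
      -- the construction is canonical: every isomorphism of networks `N ≅ N'` (in particular
      -- every automorphism of `N`) induces an isomorphism `N(Tₙ) ≅ N'(Tₙ)`, compatible with `ν`
      (∀ {V' : Type u} (N' : CapGraph V'), N'.IsNetwork → ∀ φ : N.Iso N',
        ∃ ψ : (N.structureTree n).Iso (N'.structureTree n),
          (∀ w, (ψ.toIso w).1 = (fun A => φ.toIso '' A) '' w.1) ∧
          ∀ ν' : EdgeCut.Point N'.graph → EdgeCut.Point (N'.structureTree n).graph,
            N'.IsStructureMap n ν' →
            ∀ p, ν' (EdgeCut.Point.map φ.toIso p) = EdgeCut.Point.map ψ.toIso (ν p)) := by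

  obtain ⟨ν, hν⟩ := hN.exists_isStructureMap n
  refine ⟨hN.structureTree_isNetwork n, hN.isTree_structureTree n, fun A hA => ?_,
    fun u w huw => ?_, ν, hν, fun ν' hν' => hν.unique hN hν', hν.exists_eq_inl hN, hν.eq_iff hN,
    fun M hM φ => ?_⟩
  · obtain ⟨u, w, h⟩ := CapGraph.exists_isTreeEdge_of_mem hN hA
    exact ⟨u, w, h.adj hN, h, h.cap_eq hN⟩
  · obtain ⟨A, hA⟩ := hN.exists_isTreeEdge huw
    exact ⟨A, hA, fun B hB => hA.eq_of_mem hN hB.mem (hB.notMem hN)⟩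
  · exact ⟨⟨φ.structureTreeIso n, φ.cap_structureTreeIso hN hM⟩, fun w => rfl,
      fun ν' hν' p => φ.structureMap_comm hN hM hν hν' p⟩
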